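/- Let $\Gamma$ be a chain of $g\ge 1$ loops: the $i$-th loop joins its left vertex $v_i$ to its right vertex $w_i$ by a top segment of length $l_i>0$ and a bottom segment of length $n_i>0$, and for $1\le i<g$ the vertices $w_i$ and $v_{i+1}$ either coincide or are joined by a bridge of positive length. Assume that $\Gamma$ is generic: no ratio $l_i/n_i$ equals the ratio of two positive integers whose sum is at most $2g-2$. Let $P=w_g$. For a finite Young diagram $\lambda\subset\mathbb Z_{>0}^2$, with boxes $(x,y)$ in column $x$ and row $y$, let $$W^\lambda(\Gamma)=\{D\in\mathrm{Pic}^0(\Gamma): r(D+d'P)\ge r'\text{ for all } d',r'\in\mathbb Z \text{ with } (g-d'+r',\,r'+1)\in\lambda\},$$ where $r(\cdot)$ is the Baker–Norine rank. Identify $\mathrm{Pic}^0(\Gamma)$ with the real torus $\prod_{i=1}^g\mathbb R/(l_i+n_i)\mathbb Z$ by sending $(x_i)_i$ to the class of $\sum_i\langle x_i\rangle_i-g\,w_g$, where $\langle x\rangle_i$ is the point of the $i$-th loop located $x$ units clockwise from $w_i$. A subset of $\mathrm{Pic}^0(\Gamma)$ is called polyhedral of pure dimension $k$ if its preimage in $\mathbb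 R^g$ is locally a finite union of $k$-dimensional polyhedra. For such a subset $S$, let $\mathrm{relint}(S)$ be the union of the relative interiors of its maximal faces, that is, the set of (images of) points $p$ that lie in the relative interior of some polyhedron which coincides with the preimage of $S$ in a neighbourhood of $p$. Subsets $A,B\subset Y$ of $\mathrm{Pic}^0(\Gamma)$, all polyhedral of pure dimension, intersect properly in $Y$ if $A\cap B$ is empty or polyhedral of the expected pure dimension $\dim A+\dim B-\dim Y$. Let $\alpha=(\alpha_0\le\dots\le\alpha_r)$ be integers with $0\le\alpha_i\le d-r$ (a Schubert index of type $(r,d)$). Let $\lambda_i$ be the rectangular Young diagram with $r+1-i$ rows of length $g-d+r+\alpha_i$ (empty if this number is not positive), let $\lambda^j=\lambda_0\cup\dots\cup\lambda_j$, let $W_j(\Gamma)=W^{\lambda^j}(\Gamma)$, and let $\mu_j$ be the rectangular diagram with $r-j$ rows of length $g-d+r+\alpha_j$. Then for every $0\le j<r$: 1. $W_j(\Gamma)\cap W^{\lambda_{j+1}}(\Gamma)=W_{j+1}(\Gamma)$, and $W_j(\Gamma)$ and $W^{\lambda_{j+1}}(\Gamma)$ intersect properly in $W^{\mu_j}(\Gamma)$;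 2. there is an open dense subset $U_j$ of $W_{j+1}(\Gamma)$ that is contained in $\mathrm{relint}(W^{\mu_j}(\Gamma))$. -/

import Mathlib

open Set Filter Topology

noncomputable section

/-! ### Metric graphs, divisors and their ranks -/

/-- A metric graph given by a model: vertices `V`, finitely many edges `E`, the endpoints of each
edge, and positive edge lengths. Parallel edges and loop edges are allowed. -/
structure MetricGraph where
  V : Type
  E : Type
  finite_E : Finite E
  src : E → V
  tgt : E → V
  len : E → ℝ
  len_pos : ∀ e, 0 < len e

namespace MetricGraph

/-- The points of the metric graph: vertices, and interior points of edges, the latter given by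
their distance `t` from the source of the edge. -/
inductive Point (X : MetricGraph) : Type
  | vertex (v : X.V) : Point X
  | interior (e : X.E) (t : ℝ) (h0 : 0 < t) (h1 : t < X.len e) : Point X

variable (X : MetricGraph)

open Classical in
/-- The arc-length parametrization `[0, len e] → X` of an edge (constant outside `[0, len e]`). -/
def pt (e : X.E) (t : ℝ) : X.Point :=
  if h : 0 < t ∧ t < X.len e then Point.interior e t h.1 h.2
  else if t ≤ 0 then Point.vertex (X.src e) else Point.vertex (X.tgt e)

/-- A rational function on a metric graph: a (continuous) piecewise linear real function with
integer slopes. Every tangent direction has a short initial segment on which the function is affine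
with integer slope; by compactness of edges, there are only finitely many breakpoints.
`fwd e t` and `bwd e t` are the outgoing slopes at the point `pt e t` of the edge `e`
in the direction of the target and of the source of `e`, for `t ∈ [0, len e)` and
`t ∈ (0, len e]` respectively. -/
structure RatFun where
  toFun : X.Point → ℝ
  fwd : X.E → ℝ → ℤ
  bwd : X.E → ℝ → ℤ
  fwd_spec : ∀ e t, 0 ≤ t → t < X.len e →
    ∀ᶠ s in 𝓝[>] (0 : ℝ), toFun (X.pt e (t + s)) = toFun (X.pt e t) + fwd e t * s
  bwd_spec : ∀ e t, 0 < t → t ≤ X.len e →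
    ∀ᶠ s in 𝓝[>] (0 : ℝ), toFun (X.pt e (t - s)) = toFun (X.pt e t) + bwd e t * s

/-- The order of a rational function at a point: the sum of the outgoing slopes. -/
def RatFun.ord {X : MetricGraph} (f : X.RatFun) : X.Point → ℤ
  | .vertex v =>
      (∑ᶠ e : {e : X.E // X.src e = v}, f.fwd e 0) +
        ∑ᶠ e : {e : X.E // X.tgt e = v}, f.bwd e (X.len e)
  | .interior e t _ _ => f.fwd e t + f.bwd e t

/-- Divisors. -/
abbrev Div : Type := X.Point →₀ ℤ

/-- The degree of a divisor. -/
def deg : X.Div →+ ℤ := Finsupp.liftAddHom fun _ => AddMonoidHom.id ℤ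

/-- The group of principal divisors. -/
def principal : AddSubgroup X.Div where
  carrier := {D | ∃ f : X.RatFun, ∀ p, D p = f.ord p}
  zero_mem' := by
    refine ⟨⟨fun _ => 0, fun _ _ => 0, fun _ _ => 0, by simp, by simp⟩, ?_⟩
    intro p
    cases p <;> simp [RatFun.ord]
  add_mem' := by
    rintro D D' ⟨f, hf⟩ ⟨f', hf'⟩
    refine ⟨⟨fun p => f.toFun p + f'.toFun p, fun e t => f.fwd e t + f'.fwd e t,
      fun e t => f.bwd e t + f'.bwd e t, ?_, ?_⟩, ?_⟩
    · intro e t h0 h1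
      filter_upwards [f.fwd_spec e t h0 h1, f'.fwd_spec e t h0 h1] with s h h'
      rw [h, h']; push_cast; ring
    · intro e t h0 h1
      filter_upwards [f.bwd_spec e t h0 h1, f'.bwd_spec e t h0 h1] with s h h'
      rw [h, h']; push_cast; ring
    · intro p
      have := X.finite_E
      rw [Finsupp.add_apply, hf, hf']
      cases p with
      | vertex v =>
        simp only [RatFun.ord]
        rw [finsum_add_distrib (Set.toFinite _) (Set.toFinite _),
          finsum_add_distrib (Set.toFinite _) (Set.toFinite _)]
        ring
      | interior e t h0 h1 => simp only [RatFun.ord]; ring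
  neg_mem' := by
    rintro D ⟨f, hf⟩
    refine ⟨⟨fun p => -f.toFun p, fun e t => -f.fwd e t, fun e t => -f.bwd e t, ?_, ?_⟩, ?_⟩
    · intro e t h0 h1
      filter_upwards [f.fwd_spec e t h0 h1] with s h
      rw [h]; push_cast; ring
    · intro e t h0 h1
      filter_upwards [f.bwd_spec e t h0 h1] with s h
      rw [h]; push_cast; ring
    · intro p
      have := X.finite_E
      rw [Finsupp.neg_apply, hf]
      cases p with
      | vertex v =>
        simp only [RatFun.ord]
        rw [finsum_neg_distrib, finsum_neg_distrib]
        ring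
      | interior e t h0 h1 => simp only [RatFun.ord]; ring

/-- Linear equivalence of divisors. -/
def LinEquiv (D D' : X.Div) : Prop := D - D' ∈ X.principal

/-- `r(D) ≥ k` in the sense of Baker and Norine: for every effective divisor `F` of degree `k`,
the divisor `D - F` is linearly equivalent to an effective divisor. -/
def RankAtLeast (D : X.Div) (k : ℕ) : Prop :=
  ∀ F : X.Div, 0 ≤ F → X.deg F = k → ∃ D' : X.Div, 0 ≤ D' ∧ X.LinEquiv (D - F) D'

/-- Divisors of degree zero. -/
abbrev Div0 : AddSubgroup X.Div := X.deg.ker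

/-- Divisor classes of degree zero. -/
def Pic0 : Type := X.Div0 ⧸ X.principal.addSubgroupOf X.Div0

/-- The class of a divisor of degree zero. -/
def toPic0 (D : X.Div0) : X.Pic0 := QuotientAddGroup.mk D

end MetricGraph

/-! ### Chains of loops -/

/-- A chain of `g ≥ 1` loops. The `i`-th loop joins its left vertex `v_i` to its right vertex `w_i`
by a top segment of length `top i` and a bottom segment of length `bot i`; the vertices `w_i` and
`v_{i+1}` are joined by a bridge of length `bridge i`, where length `0` means `w_i = v_{i+1}`. -/
structure ChainOfLoops (g : ℕ) where
  genus_pos : 0 < g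
  top : Fin g → ℝ
  bot : Fin g → ℝ
  bridge : Fin (g - 1) → ℝ
  top_pos : ∀ i, 0 < top i
  bot_pos : ∀ i, 0 < bot i
  bridge_nonneg : ∀ i, 0 ≤ bridge i

namespace ChainOfLoops

variable {g : ℕ} (Γ : ChainOfLoops g)

/-- Before gluing, `(i, false)` stands for `v_i` and `(i, true)` for `w_i`. We glue `w_i` and
`v_{i+1}` when the bridge between them has length zero. -/
inductive Glue : Fin g × Bool → Fin g × Bool → Prop
  | mk (i : Fin (g - 1)) (h : Γ.bridge i = 0) :
      Glue (⟨i, by omega⟩, true) (⟨i + 1, by omega⟩, false)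

/-- The left vertex of the `i`-th loop. -/
def v (i : Fin g) : Quot Γ.Glue := Quot.mk _ (i, false)

/-- The right vertex of the `i`-th loop. -/
def w (i : Fin g) : Quot Γ.Glue := Quot.mk _ (i, true)

/-- The edges of the chain: top segments `top i`, bottom segments `bot i`,
and bridges of positive length. -/
inductive Edge : Type
  | top (i : Fin g) : Edge
  | bot (i : Fin g) : Edge
  | bridge (i : Fin (g - 1)) (h : 0 < Γ.bridge i) : Edge

/-- The underlying metric graph. All edges are oriented from left to right. -/
def graph : MetricGraph where
  V := Quot Γ.Glue
  E := Γ.Edge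
  finite_E := by
    refine Finite.of_injective
      (β := Fin g ⊕ Fin g ⊕ Fin (g - 1))
      (fun e => match e with
        | .top i => Sum.inl i
        | .bot i => Sum.inr (Sum.inl i)
        | .bridge i _ => Sum.inr (Sum.inr i)) ?_
    intro a b h
    cases a <;> cases b <;> simp_all
  src
    | .top i => Γ.v i
    | .bot i => Γ.v i
    | .bridge i _ => Γ.w ⟨i, by omega⟩
  tgt
    | .top i => Γ.w i
    | .bot i => Γ.w i
    | .bridge i _ => Γ.v ⟨i + 1, by omega⟩
  len
    | .top i => Γ.top i
    | .bot i => Γ.bot i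
    | .bridge i _ => Γ.bridge i
  len_pos := by
    rintro (i | i | ⟨i, h⟩)
    exacts [Γ.top_pos i, Γ.bot_pos i, h]

/-- The rightmost vertex `w_g`. -/
def lastPoint : Γ.graph.Point :=
  .vertex (Γ.w ⟨g - 1, by have := Γ.genus_pos; omega⟩)

/-- The point of the `i`-th loop that is `z` units clockwise from `w_i`: going clockwise from `w_i`,
one follows the bottom segment to `v_i` and then the top segment back to `w_i`. -/
def loopPoint (i : Fin g) (z : ℝ) : Γ.graph.Point :=
  let s := toIcoMod (add_pos (Γ.bot_pos i) (Γ.top_pos i)) 0 z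
  if s ≤ Γ.bot i then Γ.graph.pt (Edge.bot i) (Γ.bot i - s)
  else Γ.graph.pt (Edge.top i) (s - Γ.bot i)

/-- The chain is generic if no ratio `top i / bot i` equals the ratio of two positive integers
whose sum does not exceed `2g - 2`. -/
def IsGeneric : Prop :=
  ∀ i : Fin g, ∀ a b : ℕ, 0 < a → 0 < b → a + b ≤ 2 * g - 2 → Γ.top i / Γ.bot i ≠ (a : ℝ) / b

/-- The divisor `∑ i, ⟨x i⟩ - g w_g` with one chip on each loop, the `i`-th one `x i` units
clockwise from `w_i`. -/
def coordDiv (x : Fin g → ℝ) : Γ.graph.Div0 :=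
  ⟨(∑ i, Finsupp.single (Γ.loopPoint i (x i)) 1) - (g : ℤ) • Finsupp.single Γ.lastPoint 1, by
    rw [AddMonoidHom.mem_ker, map_sub, map_sum, map_zsmul]
    simp only [MetricGraph.deg, Finsupp.liftAddHom_apply_single]
    simp⟩

/-- The degree-zero divisor classes of the chain. -/
def Pic0 : Type := Γ.graph.Pic0

/-- The universal covering `ℝ^g → Pic⁰(Γ)`, which identifies `Pic⁰(Γ)` with the real torus
`∏ i, ℝ / (top i + bot i)ℤ`. -/
def cover (x : Fin g → ℝ) : Γ.Pic0 := Γ.graph.toPic0 (Γ.coordDiv x)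

/-- `Pic⁰(Γ)` carries the topology of the real torus. -/
instance : TopologicalSpace Γ.Pic0 := TopologicalSpace.coinduced Γ.cover inferInstance

/-- The Brill–Noether locus `W^lam(Γ, w_g)` of a Young diagram `lam`, viewed as a set of boxes
`(x, y)` with positive integer coordinates. -/
def brillNoether (lam : Set (ℤ × ℤ)) : Set Γ.Pic0 :=
  {c | ∃ D : Γ.graph.Div0, Γ.graph.toPic0 D = c ∧
    ∀ (d' : ℤ) (r' : ℕ), ((g : ℤ) - d' + r', (r' : ℤ) + 1) ∈ lam →
      Γ.graph.RankAtLeast ((D : Γ.graph.Div) + d' • Finsupp.single Γ.lastPoint 1) r'}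

end ChainOfLoops

/-! ### Schubert indices and partitions -/

/-- `α = (α_0, …, α_r)` is a Schubert index of type `(r, d)`: a non-decreasing sequence of
non-negative integers bounded by `d - r`. -/
def IsSchubertIndex (r d : ℕ) (α : Fin (r + 1) → ℕ) : Prop :=
  Monotone α ∧ ∀ i, (α i : ℤ) ≤ (d : ℤ) - r

/-- The Young diagram with `rows` rows, all of length `cols`; it is empty if one of these numbers
is not positive. -/
def rectDiagram (rows cols : ℤ) : Set (ℤ × ℤ) :=
  {b | 1 ≤ b.1 ∧ b.1 ≤ cols ∧ 1 ≤ b.2 ∧ b.2 ≤ rows}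

/-- `λ_i`, the `(r + 1 - i) × (g - d + r + α_i)` diagram. -/
def lambdaRect (g d : ℕ) {r : ℕ} (α : Fin (r + 1) → ℕ) (i : Fin (r + 1)) : Set (ℤ × ℤ) :=
  rectDiagram ((r : ℤ) + 1 - (i : ℕ)) ((g : ℤ) - d + r + α i)

/-- `λ^j`, the union of `λ_0, …, λ_j`. -/
def lambdaUnion (g d : ℕ) {r : ℕ} (α : Fin (r + 1) → ℕ) (j : Fin (r + 1)) : Set (ℤ × ℤ) :=
  ⋃ i ≤ j, lambdaRect g d α i

/-- `μ_j`, the `(r - j) × (g - d + r + α_j)` diagram. -/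
def muRect (g d : ℕ) {r : ℕ} (α : Fin (r + 1) → ℕ) (j : Fin (r + 1)) : Set (ℤ × ℤ) :=
  rectDiagram ((r : ℤ) - (j : ℕ)) ((g : ℤ) - d + r + α j)

/-! ### Polyhedral geometry -/

/-- A polyhedron in `ℝ^g`: a finite intersection of closed half-spaces. -/
def IsPolyhedron {g : ℕ} (C : Set (Fin g → ℝ)) : Prop :=
  ∃ H : Set (((Fin g → ℝ) →ₗ[ℝ] ℝ) × ℝ), H.Finite ∧ C = {x | ∀ h ∈ H, h.1 x ≤ h.2}

/-- `S` is a polyhedral subset of `ℝ^g` of pure dimension `k`: near every point of `ℝ^g` it is a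
finite union of `k`-dimensional polyhedra. -/
def IsPurePolyhedral {g : ℕ} (S : Set (Fin g → ℝ)) (k : ℕ) : Prop :=
  ∀ p, ∃ F : Set (Set (Fin g → ℝ)), F.Finite ∧
    (∀ C ∈ F, IsPolyhedron C ∧ Module.finrank ℝ (vectorSpan ℝ C) = k) ∧
    S =ᶠ[𝓝 p] ⋃₀ F

/-- The union of the relative interiors of the maximal faces of a polyhedral subset `S` of `ℝ^g`:
the points `p` in the relative interior of some polyhedron that coincides with `S` near `p`. -/
def polyRelint {g : ℕ} (S : Set (Fin g → ℝ)) : Set (Fin g → ℝ) :=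
  {p | ∃ C, IsPolyhedron C ∧ p ∈ intrinsicInterior ℝ C ∧ S =ᶠ[𝓝 p] C}

namespace ChainOfLoops

variable {g : ℕ} (Γ : ChainOfLoops g)

/-- A subset of `Pic⁰(Γ)` is polyhedral of pure dimension `k` if its preimage in `ℝ^g` is. -/
def IsPure (S : Set Γ.Pic0) (k : ℕ) : Prop := IsPurePolyhedral (Γ.cover ⁻¹' S) k

/-- The union of the relative interiors of the maximal faces of a polyhedral subset of `Pic⁰(Γ)`. -/
def relint (S : Set Γ.Pic0) : Set Γ.Pic0 := Γ.cover '' polyRelint (Γ.cover ⁻¹' S)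

/-- `A` and `B` intersect properly in `Y`: all three are polyhedral of pure dimension, `A` and `B`
lie in `Y`, and `A ∩ B` is empty or has the expected pure dimension `dim A + dim B - dim Y`. -/
def IntersectProperly (A B Y : Set Γ.Pic0) : Prop :=
  A ⊆ Y ∧ B ⊆ Y ∧ ∃ a b y : ℕ, Γ.IsPure A a ∧ Γ.IsPure B b ∧ Γ.IsPure Y y ∧
    ((A ∩ B).Nonempty → ∃ k : ℕ, k + y = a + b ∧ Γ.IsPure (A ∩ B) k)

end ChainOfLoops

end

noncomputable section

/-! ### Piecewise affine functions with integer slopes on an interval -/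

/-! By the Abel–Jacobi theorem for a chain of loops (`mem_principal_iff`), a divisor class is its
degree together with one point on a circle for every loop. In these coordinates effectiveness only
concerns the numbers of chips to the left of each loop (`IsEffective`), and rank becomes a growth
process on Young diagrams. Scanning the loops from left to right, loop `i` adds the addable boxes
`(X, Y)` with `x i ≡ (Y - X) * bot i` modulo the circumference, and `r(D + d'P) ≥ r'` holds exactly
when the corresponding box is eventually added (`rankAtLeast_coordDiv_iff`). Recording the loop at
which each box is added shows that `W^λ` is a union of tori indexed by strictly increasing fillings
`t` of `λ` with loops; the torus of `t` fixes the coordinates in `range t`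
(`cover_mem_brillNoether_iff_exists_tableau`).

Genericity makes the relevant multiples of `bot i` distinct on the circle. A loop used by a tableau
through a given point therefore determines the content `Y - X` of its box, `t` is injective, and
`W^λ` is pure of dimension `g - |λ|` (`isPure_brillNoether`). The first claim follows: conditions on
a union of diagrams are imposed separately, and dimensions match by inclusion–exclusion, because
`λ^j ∩ λ_{j+1} = μ_j`.

For the second claim, `W^{μ_j}` is near a point a union of coordinate subspaces, one for each
tableau through that point. The point lies in the relative interior if all of these fix the same
coordinates, which is an open condition (`regularLocus`). To meet it arbitrarily close to a point on
the torus of a tableau `t` of shape `λ^{j+1}`, the coordinates outside `range t` are moved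
generically. Every tableau of shape `μ_j` through the new point then uses only loops of `t`, with
the same contents. Since `λ^{j+1}` does not contain the box diagonally beyond the corner of `μ_j`,
it must be the restriction of `t` (`tableau_eq_restrict`). -/

theorem eventually_ramp_add (b t : ℝ) : ∀ᶠ s in 𝓝[>] (0 : ℝ),
    max 0 (t + s - b) = max 0 (t - b) + (if b ≤ t then (1 : ℤ) else 0 : ℤ) * s := by
  by_cases h : b ≤ t
  · filter_upwards [self_mem_nhdsWithin] with s hs
    have hs : 0 < s := hs
    rw [if_pos h, max_eq_right (by linarith), max_eq_right (by linarith)]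
    push_cast; ring
  · push Not at h
    filter_upwards [Ioo_mem_nhdsGT (sub_pos.2 h)] with s hs
    rw [if_neg (not_le.2 h), max_eq_left (by linarith [hs.2]), max_eq_left (by linarith)]
    simp

theorem eventually_ramp_sub (b t : ℝ) : ∀ᶠ s in 𝓝[>] (0 : ℝ),
    max 0 (t - s - b) = max 0 (t - b) + (if b < t then (-1 : ℤ) else 0 : ℤ) * s := by
  by_cases h : b < t
  · filter_upwards [Ioo_mem_nhdsGT (sub_pos.2 h)] with s hs
    rw [if_pos h, max_eq_right (by linarith [hs.2]), max_eq_right (by linarith)]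
    push_cast; ring
  · filter_upwards [self_mem_nhdsWithin] with s hs
    have hs : 0 < s := hs
    push Not at h
    rw [if_neg (not_lt.2 h), max_eq_left (by linarith), max_eq_left (by linarith)]
    simp

theorem eventually_nhds_of_slopes {φ : ℝ → ℝ} {t a b : ℝ}
    (hf : ∀ᶠ s in 𝓝[>] (0 : ℝ), φ (t + s) = φ t + a * s)
    (hb : ∀ᶠ s in 𝓝[>] (0 : ℝ), φ (t - s) = φ t + b * s) (h : a + b = 0) :
    ∀ᶠ u in 𝓝 t, φ u = φ t + a * (u - t) := by
  obtain ⟨δ, hδ, H⟩ := mem_nhdsGT_iff_exists_Ioo_subset.1 hf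
  obtain ⟨δ', hδ', H'⟩ := mem_nhdsGT_iff_exists_Ioo_subset.1 hb
  have hδ : 0 < δ := hδ
  have hδ' : 0 < δ' := hδ'
  filter_upwards [Ioo_mem_nhds (show t - δ' < t by linarith) (show t < t + δ by linarith)] with u hu
  rcases lt_trichotomy u t with h1 | h1 | h1
  · have := H' (show t - u ∈ Ioo 0 δ' from ⟨by linarith, by linarith [hu.1]⟩)
    simp only [mem_ofPred_eq, sub_sub_cancel] at this
    rw [this, show b = -a by linarith]; ring
  · simp [h1]
  · have := H (show u - t ∈ Ioo 0 δ from ⟨by linarith, by linarith [hu.2]⟩)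
    simpa using this

/-- On the open interval `φ` is differentiable with derivative `fw`, which is locally constant and
hence constant by connectedness. The one-sided slopes at the endpoints agree with this constant, and
the mean value theorem gives the total increment. -/
theorem affine_of_no_break {φ : ℝ → ℝ} {fw bw : ℝ → ℤ} {L : ℝ} (hL : 0 < L)
    (hf : ∀ t, 0 ≤ t → t < L → ∀ᶠ s in 𝓝[>] (0 : ℝ), φ (t + s) = φ t + fw t * s)
    (hb : ∀ t, 0 < t → t ≤ L → ∀ᶠ s in 𝓝[>] (0 : ℝ), φ (t - s) = φ t + bw t * s)
    (h0 : ∀ t, 0 < t → t < L → fw t + bw t = 0) :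
    bw L = -fw 0 ∧ φ L - φ 0 = fw 0 * L := by
  have key : ∀ t ∈ Ioo 0 L, ∀ᶠ u in 𝓝 t, φ u = φ t + fw t * (u - t) := fun t ht =>
    eventually_nhds_of_slopes (hf t ht.1.le ht.2) (hb t ht.1 ht.2.le)
      (by exact_mod_cast h0 t ht.1 ht.2)
  have aff : ∀ (y m a x : ℝ), HasDerivAt (fun u => y + m * (u - a)) m x := fun y m a x => by
    simpa using (((hasDerivAt_id x).sub_const a).const_mul m).const_add y
  have hder : ∀ t ∈ Ioo 0 L, HasDerivAt φ (fw t) t := fun t ht =>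
    (aff (φ t) (fw t) t t).congr_of_eventuallyEq (key t ht)
  have hloc : ContinuousOn fw (Ioo 0 L) := by
    intro t ht
    refine ContinuousAt.continuousWithinAt ?_
    refine (continuousAt_const (y := fw t)).congr ?_
    filter_upwards [(key t ht).eventually_nhds, Ioo_mem_nhds ht.1 ht.2] with u hu hu'
    have := ((aff (φ t) (fw t) t u).congr_of_eventuallyEq hu).unique (hder u hu')
    exact_mod_cast this
  have hconst : ∀ x ∈ Ioo 0 L, ∀ y ∈ Ioo 0 L, fw x = fw y := fun x hx y hy =>
    isPreconnected_Ioo.constant hloc hx hy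
  have h0' : ∀ x ∈ Ioo 0 L, fw x = fw 0 := by
    obtain ⟨δ, hδ, H⟩ := mem_nhdsGT_iff_exists_Ioo_subset.1 (hf 0 le_rfl hL)
    have hδ : 0 < δ := hδ
    intro x hx
    set y := min δ L / 2 with hy
    have hy0 : 0 < y := by positivity
    have hyδ : y < δ := by have := min_le_left δ L; linarith [lt_min hδ hL]
    have hyL : y < L := by have := min_le_right δ L; linarith [lt_min hδ hL]
    rw [hconst x hx y ⟨hy0, hyL⟩]
    have h1 : φ =ᶠ[𝓝 y] fun u => φ 0 + fw 0 * (u - 0) := by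
      filter_upwards [Ioo_mem_nhds hy0 hyδ] with u hu
      simpa using H hu
    have := ((aff _ _ 0 y).congr_of_eventuallyEq h1).unique (hder y ⟨hy0, hyL⟩)
    exact_mod_cast this.symm
  have hL' : ∀ x ∈ Ioo 0 L, fw x = -bw L := by
    obtain ⟨δ, hδ, H⟩ := mem_nhdsGT_iff_exists_Ioo_subset.1 (hb L hL le_rfl)
    have hδ : 0 < δ := hδ
    intro x hx
    set y := min δ L / 2 with hy
    have hy0 : 0 < y := by positivity
    have hyδ : y < δ := by have := min_le_left δ L; linarith [lt_min hδ hL]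
    have hyL : y < L := by have := min_le_right δ L; linarith [lt_min hδ hL]
    have hy' : L - y ∈ Ioo 0 L := ⟨by linarith, by linarith⟩
    rw [hconst x hx _ hy']
    have h1 : φ =ᶠ[𝓝 (L - y)] fun u => φ L + ((-bw L : ℤ) : ℝ) * (u - L) := by
      filter_upwards [Ioo_mem_nhds (show L - δ < L - y by linarith)
        (show L - y < L by linarith)] with u hu
      have := H (show L - u ∈ Ioo 0 δ from ⟨by linarith [hu.2], by linarith [hu.1]⟩)
      simp only [mem_ofPred_eq, sub_sub_cancel] at this
      rw [this]; push_cast; ring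
    have := ((aff _ _ L _).congr_of_eventuallyEq h1).unique (hder _ hy')
    exact_mod_cast this.symm
  have hcont : ContinuousOn φ (Icc 0 L) := by
    intro t ht
    rcases eq_or_lt_of_le ht.1 with h | h
    · subst h
      have h1 : ContinuousWithinAt (fun u => φ 0 + fw 0 * (u - 0)) (Ici 0) (0 : ℝ) :=
        (aff _ _ 0 0).continuousAt.continuousWithinAt
      refine ContinuousWithinAt.mono (t := Ici 0) ?_ Icc_subset_Ici_self
      refine h1.congr_of_eventuallyEq ?_ (by simp)
      rw [EventuallyEq, ← Ioi_insert, nhdsWithin_insert, eventually_sup, eventually_pure]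
      refine ⟨by simp, ?_⟩
      filter_upwards [hf 0 le_rfl hL] with s hs
      simpa using hs
    rcases eq_or_lt_of_le ht.2 with h' | h'
    · subst h'
      have h1 : ContinuousWithinAt (fun u => φ t + ((-bw t : ℤ) : ℝ) * (u - t)) (Iic t) t :=
        (aff _ _ t t).continuousAt.continuousWithinAt
      refine ContinuousWithinAt.mono (t := Iic t) ?_ Icc_subset_Iic_self
      refine h1.congr_of_eventuallyEq ?_ (by simp)
      rw [EventuallyEq, ← Iio_insert, nhdsWithin_insert, eventually_sup, eventually_pure]
      refine ⟨by simp, ?_⟩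
      obtain ⟨δ, hδ, H⟩ := mem_nhdsGT_iff_exists_Ioo_subset.1 (hb t hL le_rfl)
      have hδ : 0 < δ := hδ
      filter_upwards [Ioo_mem_nhdsLT (show t - δ < t by linarith)] with u hu
      have := H (show t - u ∈ Ioo 0 δ from ⟨by linarith [hu.2], by linarith [hu.1]⟩)
      simp only [mem_ofPred_eq, sub_sub_cancel] at this
      rw [this]; push_cast; ring
    · exact (hder t ⟨h, h'⟩).continuousAt.continuousWithinAt
  obtain ⟨x, hx, hs⟩ := exists_hasDerivAt_eq_slope φ (fun t => (fw t : ℝ)) hL hcont hder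
  refine ⟨?_, ?_⟩
  · have := h0' x hx; have := hL' x hx; omega
  · simp only [h0' x hx] at hs
    rw [hs, sub_zero, div_mul_cancel₀ _ hL.ne']

/-- Degree and first moment of the divisor of a piecewise affine function on an interval. -/
theorem sum_breaks {φ : ℝ → ℝ} {fw bw : ℝ → ℤ} {L : ℝ} (hL : 0 < L)
    (hf : ∀ t, 0 ≤ t → t < L → ∀ᶠ s in 𝓝[>] (0 : ℝ), φ (t + s) = φ t + fw t * s)
    (hb : ∀ t, 0 < t → t ≤ L → ∀ᶠ s in 𝓝[>] (0 : ℝ), φ (t - s) = φ t + bw t * s)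
    (B : Finset ℝ) (hB : ∀ t ∈ B, 0 < t ∧ t < L)
    (h0 : ∀ t, 0 < t → t < L → t ∉ B → fw t + bw t = 0) (a k : ℝ) :
    ∑ t ∈ B, ((fw t + bw t : ℤ) : ℝ) * (a + k * t) =
      -a * fw 0 - (a + k * L) * bw L - k * (φ L - φ 0) := by
  set o : ℝ → ℤ := fun t => fw t + bw t with ho
  -- Subtracting from `φ` a ramp of slope `o b` starting at each break `b` leaves a function without
  -- breaks.
  have H := affine_of_no_break (φ := fun t => φ t - ∑ b ∈ B, (o b : ℝ) * max 0 (t - b))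
    (fw := fun t => fw t - ∑ b ∈ B, o b * (if b ≤ t then 1 else 0))
    (bw := fun t => bw t - ∑ b ∈ B, o b * (if b < t then -1 else 0)) hL ?_ ?_ ?_
  · obtain ⟨H1, H2⟩ := H
    have e1 : ∑ b ∈ B, o b * (if b ≤ 0 then 1 else 0) = 0 := Finset.sum_eq_zero fun b hb => by
      rw [if_neg (not_le.2 (hB b hb).1), mul_zero]
    have e2 : ∑ b ∈ B, o b * (if b < L then -1 else 0) = -∑ b ∈ B, o b := by
      rw [← Finset.sum_neg_distrib]
      exact Finset.sum_congr rfl fun b hb => by rw [if_pos (hB b hb).2, mul_neg_one]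
    have e3 : ∑ b ∈ B, (o b : ℝ) * max 0 (0 - b) = 0 := Finset.sum_eq_zero fun b hb => by
      rw [max_eq_left (by linarith [(hB b hb).1]), mul_zero]
    have e4 : ∑ b ∈ B, (o b : ℝ) * max 0 (L - b) =
        L * (∑ b ∈ B, o b : ℤ) - ∑ b ∈ B, (o b : ℝ) * b := by
      push_cast
      rw [Finset.mul_sum, ← Finset.sum_sub_distrib]
      exact Finset.sum_congr rfl fun b hb => by
        rw [max_eq_right (by linarith [(hB b hb).2])]; ring
    simp only [e1, e2, e3, e4, sub_zero, sub_neg_eq_add] at H1 H2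
    have h1 : ((∑ b ∈ B, o b : ℤ) : ℝ) = -fw 0 - bw L := by
      have : (∑ b ∈ B, o b : ℤ) = -fw 0 - bw L := by omega
      rw [this]; push_cast; ring
    have h2 : ∑ t ∈ B, (o t : ℝ) * (a + k * t) =
        a * (∑ b ∈ B, o b : ℤ) + k * ∑ b ∈ B, (o b : ℝ) * b := by
      push_cast
      rw [Finset.mul_sum, Finset.mul_sum, ← Finset.sum_add_distrib]
      exact Finset.sum_congr rfl fun b _ => by ring
    rw [h2]
    linear_combination k * H2 + (a + k * L) * h1
  · intro t h1 h2
    have : ∀ᶠ s in 𝓝[>] (0 : ℝ), ∀ b ∈ B, max 0 (t + s - b) =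
        max 0 (t - b) + (if b ≤ t then (1 : ℤ) else 0 : ℤ) * s :=
      (Finset.eventually_all B).2 fun b _ => eventually_ramp_add b t
    filter_upwards [this, hf t h1 h2] with s hs hs'
    rw [hs', Finset.sum_congr rfl fun b hb => by rw [hs b hb]]
    simp only [mul_add, Finset.sum_add_distrib]
    push_cast
    rw [sub_mul, Finset.sum_mul]
    simp only [mul_assoc]
    ring
  · intro t h1 h2
    have : ∀ᶠ s in 𝓝[>] (0 : ℝ), ∀ b ∈ B, max 0 (t - s - b) =
        max 0 (t - b) + (if b < t then (-1 : ℤ) else 0 : ℤ) * s :=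
      (Finset.eventually_all B).2 fun b _ => eventually_ramp_sub b t
    filter_upwards [this, hb t h1 h2] with s hs hs'
    rw [hs', Finset.sum_congr rfl fun b hb => by rw [hs b hb]]
    simp only [mul_add, Finset.sum_add_distrib]
    push_cast
    rw [sub_mul, Finset.sum_mul]
    simp only [mul_assoc]
    ring
  · intro t h1 h2
    have : ∀ b, o b * (if b ≤ t then 1 else 0) + o b * (if b < t then -1 else 0) =
        if b = t then o t else 0 := by
      intro b
      rcases lt_trichotomy b t with h | h | h
      · simp [h, h.le, h.ne]
      · simp [h]
      · simp [h.not_ge, h.not_gt, h.ne']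
    have e : ∑ b ∈ B, o b * (if b ≤ t then 1 else 0) + ∑ b ∈ B, o b * (if b < t then -1 else 0) =
        o t := by
      rw [← Finset.sum_add_distrib, Finset.sum_congr rfl fun b _ => this b, Finset.sum_ite_eq']
      split_ifs with h
      · rfl
      · exact (h0 t h1 h2 h).symm
    have e' : o t = fw t + bw t := rfl
    omega

/-! ### Divisors of rational functions on a metric graph -/

namespace MetricGraph

variable {X : MetricGraph}

@[simp] theorem pt_zero (e : X.E) : X.pt e 0 = .vertex (X.src e) := by simp [pt]

@[simp] theorem pt_len (e : X.E) : X.pt e (X.len e) = .vertex (X.tgt e) := by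
  simp [pt, X.len_pos e]

theorem pt_interior (e : X.E) {t : ℝ} (h0 : 0 < t) (h1 : t < X.len e) :
    X.pt e t = .interior e t h0 h1 := by simp [pt, h0, h1]

/-- The edge containing a point in its interior. -/
def Point.edge? : X.Point → Option X.E
  | .vertex _ => none
  | .interior e _ _ _ => some e

/-- The position of a point in the interior of an edge. -/
def Point.param : X.Point → ℝ
  | .vertex _ => 0
  | .interior _ t _ _ => t

open Classical in
theorem finsum_subtype_eq_sum_ite {E V M : Type*} [Fintype E] [AddCommMonoid M] (φ : E → V)
    (F : E → M) (v : V) : ∑ᶠ e : {e : E // φ e = v}, F e = ∑ e, if φ e = v then F e else 0 := by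
  rw [finsum_eq_sum_of_fintype, ← Finset.sum_filter]
  exact (Finset.sum_subtype (Finset.univ.filter fun e => φ e = v) (by simp) F).symm

open Classical in
theorem ord_vertex [Fintype X.E] (f : X.RatFun) (v : X.V) :
    f.ord (.vertex v) = (∑ e, if X.src e = v then f.fwd e 0 else 0) +
      ∑ e, if X.tgt e = v then f.bwd e (X.len e) else 0 := by
  simp only [RatFun.ord]
  rw [finsum_subtype_eq_sum_ite X.src (fun e => f.fwd e 0),
    finsum_subtype_eq_sum_ite X.tgt (fun e => f.bwd e (X.len e))]

/-- Pairing of a principal divisor with a function that is affine on the interior of every edge. -/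
theorem sum_principal [Fintype X.E] (f : X.RatFun) (D : X.Div) (hD : ∀ p, D p = f.ord p)
    (χ : X.Point → ℝ) (a k : X.E → ℝ)
    (hχ : ∀ e t h0 h1, χ (.interior e t h0 h1) = a e + k e * t) :
    D.sum (fun p m => (m : ℝ) * χ p) =
      ∑ e, ((χ (.vertex (X.src e)) - a e) * f.fwd e 0 +
        (χ (.vertex (X.tgt e)) - a e - k e * X.len e) * f.bwd e (X.len e) -
        k e * (f.toFun (.vertex (X.tgt e)) - f.toFun (.vertex (X.src e)))) := by
  classical
  have hedge : ∀ e, ∑ p ∈ D.support with p.edge? = some e, (D p : ℝ) * χ p =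
      -a e * f.fwd e 0 - (a e + k e * X.len e) * f.bwd e (X.len e) -
        k e * (f.toFun (.vertex (X.tgt e)) - f.toFun (.vertex (X.src e))) := by
    intro e
    have key := sum_breaks (φ := fun t => f.toFun (X.pt e t)) (X.len_pos e) (f.fwd_spec e)
      (f.bwd_spec e) ((D.support.filter fun p => p.edge? = some e).image Point.param) ?_ ?_
      (a e) (k e)
    · rw [Finset.sum_image] at key
      · simp only [pt_zero, pt_len] at key
        rw [← key]
        refine Finset.sum_congr rfl fun p hp => ?_
        obtain ⟨-, hp⟩ := Finset.mem_filter.1 hp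
        cases p with
        | vertex v => simp [Point.edge?] at hp
        | interior e' t h0 h1 =>
          obtain rfl : e' = e := by simpa [Point.edge?] using hp
          rw [hD, hχ]; rfl
      · intro p hp q hq h
        have hp := (Finset.mem_filter.1 hp).2
        have hq := (Finset.mem_filter.1 hq).2
        cases p <;> cases q <;> simp_all [Point.edge?, Point.param]
    · intro t ht
      obtain ⟨p, hp, rfl⟩ := Finset.mem_image.1 ht
      have hp := (Finset.mem_filter.1 hp).2
      cases p with
      | vertex v => simp [Point.edge?] at hp
      | interior e' t h0 h1 =>
        obtain rfl : e' = e := by simpa [Point.edge?] using hp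
        exact ⟨h0, h1⟩
    · intro t h0 h1 ht
      by_contra h
      refine ht (Finset.mem_image.2 ⟨.interior e t h0 h1, ?_, rfl⟩)
      rw [Finset.mem_filter, Finsupp.mem_support_iff, hD]
      exact ⟨h, rfl⟩
  have hvert : ∑ p ∈ D.support with p.edge? = none, (D p : ℝ) * χ p =
      ∑ e, (χ (.vertex (X.src e)) * f.fwd e 0 + χ (.vertex (X.tgt e)) * f.bwd e (X.len e)) := by
    -- The vertex type need not be finite, but a vertex at which no edge starts or ends has order
    -- zero. So the sum may be taken over the endpoints of edges.
    set S : Finset X.V := Finset.univ.image X.src ∪ Finset.univ.image X.tgt with hS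
    have h1 : ∑ p ∈ D.support with p.edge? = none, (D p : ℝ) * χ p =
        ∑ p ∈ S.image Point.vertex, (D p : ℝ) * χ p := by
      refine Finset.sum_subset ?_ ?_
      · intro p hp
        obtain ⟨hp, hp'⟩ := Finset.mem_filter.1 hp
        cases p with
        | interior e t h0 h1 => simp [Point.edge?] at hp'
        | vertex v =>
          refine Finset.mem_image_of_mem _ ?_
          by_contra hv
          simp only [hS, Finset.mem_union, Finset.mem_image, Finset.mem_univ, true_and,
            not_or, not_exists] at hv
          refine Finsupp.mem_support_iff.1 hp ?_
          rw [hD, ord_vertex]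
          simp [hv.1, hv.2]
      · intro p hp hp'
        obtain ⟨v, -, rfl⟩ := Finset.mem_image.1 hp
        have : D (.vertex v) = 0 := by
          by_contra h
          exact hp' (Finset.mem_filter.2 ⟨Finsupp.mem_support_iff.2 h, rfl⟩)
        simp [this]
    rw [h1, Finset.sum_image (fun _ _ _ _ h => by simpa using h)]
    have h2 : ∀ v, (D (.vertex v) : ℝ) * χ (.vertex v) =
        ∑ e, ((if X.src e = v then χ (.vertex v) * f.fwd e 0 else 0) +
          if X.tgt e = v then χ (.vertex v) * f.bwd e (X.len e) else 0) := by
      intro v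
      rw [hD, ord_vertex, Finset.sum_add_distrib]
      push_cast
      rw [add_mul, Finset.sum_mul, Finset.sum_mul]
      congr 1 <;> refine Finset.sum_congr rfl fun e _ => ?_ <;> split_ifs <;> ring
    rw [Finset.sum_congr rfl fun v _ => h2 v, Finset.sum_comm]
    refine Finset.sum_congr rfl fun e _ => ?_
    rw [Finset.sum_add_distrib, Finset.sum_ite_eq, Finset.sum_ite_eq, if_pos (by simp [hS]),
      if_pos (by simp [hS])]
  rw [Finsupp.sum, ← Finset.sum_fiberwise D.support Point.edge?, Fintype.sum_option, hvert,
    Finset.sum_congr rfl fun e _ => hedge e, ← Finset.sum_add_distrib]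
  exact Finset.sum_congr rfl fun e _ => by ring

open Classical in
/-- The function `u ↦ max 0 (u - t)` of a point `t` in the interior of the edge `e`. -/
def ramp (e : X.E) (u : ℝ) : X.Point → ℝ
  | .vertex _ => 0
  | .interior e' t _ _ => if e' = e then max 0 (u - t) else 0

open Classical in
/-- The indicator function of the points in the interior of an edge up to the position `u`. -/
def upTo (e : X.E) (u : ℝ) : X.Point → ℤ
  | .vertex _ => 0
  | .interior e' t _ _ => if e' = e ∧ t ≤ u then 1 else 0

open Classical in
/-- The indicator function of the points in the interior of an edge before the position `u`. -/
def before (e : X.E) (u : ℝ) : X.Point → ℤ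
  | .vertex _ => 0
  | .interior e' t _ _ => if e' = e ∧ t < u then 1 else 0

theorem eventually_ramp_fwd (e : X.E) (u : ℝ) (p : X.Point) : ∀ᶠ s in 𝓝[>] (0 : ℝ),
    ramp e (u + s) p = ramp e u p + upTo e u p * s := by
  cases p with
  | vertex v => simp [ramp, upTo]
  | interior e' t h0 h1 =>
    by_cases h : e' = e
    · filter_upwards [eventually_ramp_add t u] with s hs
      simp only [ramp, upTo, h, true_and, if_true, hs]
    · simp [ramp, upTo, h]

theorem eventually_ramp_bwd (e : X.E) (u : ℝ) (p : X.Point) : ∀ᶠ s in 𝓝[>] (0 : ℝ),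
    ramp e (u - s) p = ramp e u p - before e u p * s := by
  cases p with
  | vertex v => simp [ramp, before]
  | interior e' t h0 h1 =>
    by_cases h : e' = e
    · filter_upwards [eventually_ramp_sub t u] with s hs
      simp only [ramp, before, h, true_and, if_true, hs]
      split_ifs <;> push_cast <;> ring
    · simp [ramp, before, h]

/-- The divisor of the rational function with slope `s e` at the start of the edge `e` and with
prescribed divisor in the interior of the edges. -/
theorem mem_principal_of_slopes [Fintype X.E] [DecidableEq X.V] (D : X.Div) (s : X.E → ℤ)
    (Φ : X.V → ℝ)
    (hΦ : ∀ e, Φ (X.tgt e) = Φ (X.src e) + s e * X.len e +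
      D.sum (fun p m => (m : ℝ) * ramp e (X.len e) p))
    (hv : ∀ v, (∑ e, if X.src e = v then s e else 0) -
      (∑ e, if X.tgt e = v then s e + D.sum (fun p m => m * before e (X.len e) p) else 0) =
        D (.vertex v)) : D ∈ X.principal := by
  classical
  -- On an edge `F` is obtained by integrating from the source: initial value, initial slope, and a
  -- ramp for every chip passed. The hypothesis `hΦ` says that the result fits the value at the
  -- target.
  let F : X.Point → ℝ
    | .vertex v => Φ v
    | .interior e t _ _ => Φ (X.src e) + s e * t + D.sum (fun p m => (m : ℝ) * ramp e t p)
  have hF : ∀ e u, 0 ≤ u → u ≤ X.len e → F (X.pt e u) =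
      Φ (X.src e) + s e * u + D.sum (fun p m => (m : ℝ) * ramp e u p) := by
    intro e u h0 h1
    rcases eq_or_lt_of_le h0 with rfl | h0
    · have : ∀ p : X.Point, ramp e 0 p = 0 := by
        rintro (v | ⟨e', t, h0, h1⟩)
        · rfl
        · simp [ramp, h0.le]
      simp [F, this]
    rcases eq_or_lt_of_le h1 with rfl | h1
    · rw [pt_len]; exact hΦ e
    · rw [pt_interior e h0 h1]
  refine ⟨⟨F, fun e t => s e + D.sum (fun p m => m * upTo e t p),
    fun e t => -(s e + D.sum (fun p m => m * before e t p)), ?_, ?_⟩, ?_⟩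
  · intro e t h0 h1
    have : ∀ᶠ u in 𝓝[>] (0 : ℝ), ∀ p ∈ D.support,
        ramp e (t + u) p = ramp e t p + upTo e t p * u :=
      (Finset.eventually_all _).2 fun p _ => eventually_ramp_fwd e t p
    filter_upwards [this, Ioo_mem_nhdsGT (sub_pos.2 h1)] with u hu hu'
    rw [hF e _ (by linarith [hu'.1]) (by linarith [hu'.2]), hF e t h0 h1.le, Finsupp.sum,
      Finset.sum_congr rfl fun p hp => by rw [hu p hp]]
    simp only [Finsupp.sum, mul_add, Finset.sum_add_distrib]
    push_cast
    rw [add_mul, Finset.sum_mul]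
    simp only [mul_assoc]
    ring
  · intro e t h0 h1
    have : ∀ᶠ u in 𝓝[>] (0 : ℝ), ∀ p ∈ D.support,
        ramp e (t - u) p = ramp e t p - before e t p * u :=
      (Finset.eventually_all _).2 fun p _ => eventually_ramp_bwd e t p
    filter_upwards [this, Ioo_mem_nhdsGT h0] with u hu hu'
    rw [hF e _ (by linarith [hu'.2]) (by linarith [hu'.1]), hF e t h0.le h1, Finsupp.sum,
      Finset.sum_congr rfl fun p hp => by rw [hu p hp]]
    simp only [Finsupp.sum, mul_sub, Finset.sum_sub_distrib]
    push_cast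
    rw [neg_mul, add_mul, Finset.sum_mul]
    simp only [mul_assoc]
    ring
  · intro p
    cases p with
    | vertex v =>
      rw [ord_vertex, ← hv v, sub_eq_add_neg, ← Finset.sum_neg_distrib]
      have : ∀ e (p : X.Point), upTo e 0 p = 0 := by
        rintro e (v | ⟨e', t, h0, h1⟩)
        · rfl
        · simp [upTo, h0]
      simp only [this, mul_zero, Finsupp.sum_fun_zero, add_zero]
      congr 1
      · exact Finset.sum_congr rfl fun e _ => by split_ifs <;> rfl
    | interior e t h0 h1 =>
      simp only [RatFun.ord]
      have : ∀ p : X.Point, upTo e t p - before e t p = if p = .interior e t h0 h1 then 1 else 0 := by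
        rintro (v | ⟨e', t', h0', h1'⟩)
        · simp [upTo, before]
        · by_cases he : e' = e
          · subst he
            rcases lt_trichotomy t' t with h | h | h
            · simp [upTo, before, h, h.le, h.ne]
            · simp [upTo, before, h]
            · simp [upTo, before, h.not_gt, h.not_ge, h.ne']
          · simp [upTo, before, he]
      have e1 : D.sum (fun p m => m * upTo e t p) =
          D.sum (fun p m => m * before e t p) + D (.interior e t h0 h1) := by
        rw [← sub_eq_iff_eq_add', Finsupp.sum, Finsupp.sum, ← Finset.sum_sub_distrib]
        simp only [← mul_sub, this, mul_ite, mul_one, mul_zero]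
        rw [Finset.sum_ite_eq']
        simp only [Finsupp.mem_support_iff, ite_not]
        split_ifs with h
        · exact h.symm
        · rfl
      rw [e1]; ring

end MetricGraph

/-! ### Levels of points and the Abel–Jacobi theorem for a chain of loops -/

namespace ChainOfLoops

open MetricGraph

variable {g : ℕ} (Γ : ChainOfLoops g)

instance : Fintype Γ.graph.E := @Fintype.ofFinite _ Γ.graph.finite_E

/-- The top edge of a loop. -/
def topE (i : Fin g) : Γ.graph.E := Edge.top i

/-- The bottom edge of a loop. -/
def botE (i : Fin g) : Γ.graph.E := Edge.bot i

/-- A bridge of positive length. -/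
def bridgeE (b : Fin (g - 1)) (h : 0 < Γ.bridge b) : Γ.graph.E := Edge.bridge b h

theorem src_botE (i : Fin g) : Γ.graph.src (Γ.botE i) = Γ.v i := rfl
theorem tgt_botE (i : Fin g) : Γ.graph.tgt (Γ.botE i) = Γ.w i := rfl
theorem len_topE (i : Fin g) : Γ.graph.len (Γ.topE i) = Γ.top i := rfl
theorem len_botE (i : Fin g) : Γ.graph.len (Γ.botE i) = Γ.bot i := rfl

theorem topE_inj {i k : Fin g} : Γ.topE i = Γ.topE k ↔ i = k :=
  ⟨fun h => Edge.top.inj h, congrArg _⟩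
theorem botE_inj {i k : Fin g} : Γ.botE i = Γ.botE k ↔ i = k :=
  ⟨fun h => Edge.bot.inj h, congrArg _⟩
theorem topE_ne_botE (i k : Fin g) : Γ.topE i ≠ Γ.botE k := by
  unfold topE botE; rintro ⟨⟩
theorem topE_ne_bridgeE (i : Fin g) (b : Fin (g - 1)) (h : 0 < Γ.bridge b) :
    Γ.topE i ≠ Γ.bridgeE b h := by
  unfold topE bridgeE; rintro ⟨⟩
theorem botE_ne_bridgeE (i : Fin g) (b : Fin (g - 1)) (h : 0 < Γ.bridge b) :
    Γ.botE i ≠ Γ.bridgeE b h := by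
  unfold botE bridgeE; rintro ⟨⟩
theorem bridgeE_inj {b b' : Fin (g - 1)} {h : 0 < Γ.bridge b} {h' : 0 < Γ.bridge b'} :
    Γ.bridgeE b h = Γ.bridgeE b' h' ↔ b = b' :=
  ⟨fun h => Edge.bridge.inj h, by rintro rfl; rfl⟩

theorem point_cases {motive : Γ.graph.Point → Prop} (vertex : ∀ v, motive (.vertex v))
    (top : ∀ k t h0 h1, motive (.interior (Γ.topE k) t h0 h1))
    (bot : ∀ k t h0 h1, motive (.interior (Γ.botE k) t h0 h1))
    (bridge : ∀ b hb t h0 h1, motive (.interior (Γ.bridgeE b hb) t h0 h1)) (p : Γ.graph.Point) :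
    motive p := by
  rcases p with v | ⟨k | k | ⟨b, hb⟩, t, h0, h1⟩
  exacts [vertex v, top k t h0 h1, bot k t h0 h1, bridge b hb t h0 h1]

theorem sum_edge {M : Type*} [AddCommMonoid M] (F : Γ.graph.E → M) :
    ∑ e, F e = (∑ i, F (Γ.topE i)) + (∑ i, F (Γ.botE i)) +
      ∑ b, if h : 0 < Γ.bridge b then F (Γ.bridgeE b h) else 0 := by
  classical
  let eqv : Fin g ⊕ Fin g ⊕ {b // 0 < Γ.bridge b} ≃ Γ.graph.E :=
    { toFun := Sum.elim Edge.top (Sum.elim Edge.bot fun b => Edge.bridge b.1 b.2)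
      invFun := fun e => match e with
        | .top i => Sum.inl i
        | .bot i => Sum.inr (Sum.inl i)
        | .bridge i h => Sum.inr (Sum.inr ⟨i, h⟩)
      left_inv := by rintro (i | i | ⟨i, h⟩) <;> rfl
      right_inv := by rintro (i | i | ⟨i, h⟩) <;> rfl }
  rw [← eqv.sum_comp, Fintype.sum_sum_type, Fintype.sum_sum_type, ← add_assoc]
  congr 1
  have : ∀ b, (if h : 0 < Γ.bridge b then F (Γ.bridgeE b h) else 0) =
      if 0 < Γ.bridge b then (if h : 0 < Γ.bridge b then F (Γ.bridgeE b h) else 0) else 0 := by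
    intro b; split_ifs <;> rfl
  rw [Finset.sum_congr rfl fun b _ => this b, ← Finset.sum_filter]
  rw [Finset.sum_subtype (p := fun b => 0 < Γ.bridge b) _ (by simp)]
  refine Finset.sum_congr rfl fun b _ => ?_
  rw [dif_pos b.2]; rfl

/-- The circumference of a loop. -/
def circ (i : Fin g) : ℝ := Γ.bot i + Γ.top i

theorem circ_pos (i : Fin g) : 0 < Γ.circ i := add_pos (Γ.bot_pos i) (Γ.top_pos i)

/-- The left vertex of the `i`-th loop is glued to the right vertex of the previous loop. -/
def IsGlued (i : Fin g) : Prop := ∃ b : Fin (g - 1), b.1 + 1 = i.1 ∧ Γ.bridge b = 0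

open Classical in
/-- The level of a vertex, increasing from left to right. -/
def vertexLevel : Γ.graph.V → ℕ :=
  -- Loop `i` has four levels: `4i + 1` for its left vertex, `4i + 2` for the interiors of its
  -- segments, `4i + 3` for its right vertex and `4i + 4` for the interior of the next bridge. A
  -- glued left vertex takes the level `4i - 1` of the right vertex before it.
  Quot.lift (fun x => if x.2 = true then 4 * x.1.1 + 3 else
    if Γ.IsGlued x.1 then 4 * x.1.1 - 1 else 4 * x.1.1 + 1) (by
      rintro _ _ ⟨b, h⟩
      have : Γ.IsGlued ⟨b + 1, by omega⟩ := ⟨b, rfl, h⟩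
      simp only [if_true, this, Bool.false_eq_true, if_false]
      omega)

@[simp] theorem vertexLevel_w (i : Fin g) : Γ.vertexLevel (Γ.w i) = 4 * i.1 + 3 := rfl

theorem vertexLevel_v_of_isGlued {i : Fin g} (h : Γ.IsGlued i) :
    Γ.vertexLevel (Γ.v i) = 4 * i.1 - 1 := if_pos h

theorem vertexLevel_v_of_not_isGlued {i : Fin g} (h : ¬Γ.IsGlued i) :
    Γ.vertexLevel (Γ.v i) = 4 * i.1 + 1 := if_neg h

theorem v_eq_w {i : Fin g} {b : Fin (g - 1)} (hb : b.1 + 1 = i.1) (h : Γ.bridge b = 0) :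
    Γ.v i = Γ.w ⟨b, by omega⟩ := by
  obtain ⟨i, hi⟩ := i
  obtain rfl : b.1 + 1 = i := hb
  exact (Quot.sound (Glue.mk b h)).symm

theorem vertex_cases {motive : Γ.graph.V → Prop} (hw : ∀ i, motive (Γ.w i))
    (hv : ∀ i, ¬Γ.IsGlued i → motive (Γ.v i)) (q : Γ.graph.V) : motive q := by
  obtain ⟨⟨i, b⟩, rfl⟩ := Quot.exists_rep q
  cases b with
  | true => exact hw i
  | false =>
    by_cases h : Γ.IsGlued i
    · obtain ⟨b, hb, h⟩ := h
      have := hw ⟨b, by omega⟩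
      rwa [← Γ.v_eq_w hb h] at this
    · exact hv i h

theorem vertexLevel_injective : Function.Injective Γ.vertexLevel := by
  intro q q'
  induction q using Γ.vertex_cases with
  | hw i =>
    induction q' using Γ.vertex_cases with
    | hw j =>
      intro h
      simp only [vertexLevel_w] at h
      congr 1; ext; omega
    | hv j hj =>
      rw [vertexLevel_w, Γ.vertexLevel_v_of_not_isGlued hj]
      intro h; omega
  | hv i hi =>
    induction q' using Γ.vertex_cases with
    | hw j =>
      rw [vertexLevel_w, Γ.vertexLevel_v_of_not_isGlued hi]
      intro h; omega
    | hv j hj =>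
      rw [Γ.vertexLevel_v_of_not_isGlued hi, Γ.vertexLevel_v_of_not_isGlued hj]
      intro h
      congr 1; ext; omega

theorem vertexLevel_v_le_iff (i k : Fin g) : Γ.vertexLevel (Γ.v k) ≤ 4 * i.1 + 1 ↔ k ≤ i := by
  rw [Fin.le_def]
  by_cases h : Γ.IsGlued k
  · rw [Γ.vertexLevel_v_of_isGlued h]; omega
  · rw [Γ.vertexLevel_v_of_not_isGlued h]; omega

theorem one_le_vertexLevel (q : Γ.graph.V) : 1 ≤ Γ.vertexLevel q := by
  induction q using Γ.vertex_cases with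
  | hw i => rw [vertexLevel_w]; omega
  | hv i hi => rw [Γ.vertexLevel_v_of_not_isGlued hi]; omega

theorem vertexLevel_lt (q : Γ.graph.V) : Γ.vertexLevel q < 4 * g := by
  induction q using Γ.vertex_cases with
  | hw i => rw [vertexLevel_w]; omega
  | hv i hi => rw [Γ.vertexLevel_v_of_not_isGlued hi]; omega

/-- The level of a point, weakly increasing from left to right. -/
def level : Γ.graph.Point → ℕ
  | .vertex q => Γ.vertexLevel q
  | .interior e _ _ _ => match e with
    | Edge.top i => 4 * i.1 + 2
    | Edge.bot i => 4 * i.1 + 2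
    | Edge.bridge b _ => 4 * b.1 + 4

theorem level_vertex (q : Γ.graph.V) : Γ.level (.vertex q) = Γ.vertexLevel q := rfl
theorem level_topE (k : Fin g) (t h0 h1) :
    Γ.level (.interior (Γ.topE k) t h0 h1) = 4 * k.1 + 2 := rfl
theorem level_botE (k : Fin g) (t h0 h1) :
    Γ.level (.interior (Γ.botE k) t h0 h1) = 4 * k.1 + 2 := rfl
theorem level_bridgeE (b : Fin (g - 1)) (hb t h0 h1) :
    Γ.level (.interior (Γ.bridgeE b hb) t h0 h1) = 4 * b.1 + 4 := rfl

theorem one_le_level (p : Γ.graph.Point) : 1 ≤ Γ.level p := by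
  rcases p with v | ⟨i | i | ⟨b, h⟩, t, h0, h1⟩
  · exact Γ.one_le_vertexLevel v
  all_goals simp [level]

theorem level_lt (p : Γ.graph.Point) : Γ.level p < 4 * g := by
  rcases p with v | ⟨i | i | ⟨b, h⟩, t, h0, h1⟩
  · exact Γ.vertexLevel_lt v
  all_goals simp only [level]; omega

/-- The constant term of the position on the `i`-th loop along an edge. -/
def posConst (i : Fin g) : Γ.graph.E → ℝ
  | Edge.top k => if k ≤ i then Γ.bot i else 0
  | Edge.bot k => if k ≤ i then Γ.bot i else 0
  | Edge.bridge b _ => if b.1 < i.1 then Γ.bot i else 0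

/-- The slope of the position on the `i`-th loop along an edge. -/
def posSlope (i : Fin g) : Γ.graph.E → ℝ
  | Edge.top k => if k = i then 1 else 0
  | Edge.bot k => if k = i then -1 else 0
  | Edge.bridge _ _ => 0

/-- The position, clockwise from the right vertex, of the retraction of a point to the `i`-th
loop. -/
def pos (i : Fin g) : Γ.graph.Point → ℝ
  | .vertex q => if Γ.vertexLevel q ≤ 4 * i.1 + 1 then Γ.bot i else 0
  | .interior e t _ _ => Γ.posConst i e + Γ.posSlope i e * t

theorem pos_v (i k : Fin g) :
    Γ.pos i (.vertex (Γ.v k)) = if k ≤ i then Γ.bot i else 0 := by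
  simp only [pos, vertexLevel_v_le_iff]

theorem pos_w (i k : Fin g) :
    Γ.pos i (.vertex (Γ.w k)) = if k < i then Γ.bot i else 0 := by
  simp only [pos, vertexLevel_w, Fin.lt_def]
  congr 1
  simp only [eq_iff_iff]; omega

theorem pos_of_level_le {i : Fin g} {p : Γ.graph.Point} (h : Γ.level p ≤ 4 * i.1 + 1) :
    Γ.pos i p = Γ.bot i := by
  rcases p with v | ⟨k | k | ⟨b, hb⟩, t, h0, h1⟩
  · exact if_pos h
  all_goals simp only [level] at h
  · have : k < i := by rw [Fin.lt_def]; omega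
    simp [pos, posConst, posSlope, this.le, this.ne]
  · have : k < i := by rw [Fin.lt_def]; omega
    simp [pos, posConst, posSlope, this.le, this.ne]
  · have : b.1 < i.1 := by omega
    simp [pos, posConst, posSlope, this]

theorem pos_of_lt_level {i : Fin g} {p : Γ.graph.Point} (h : 4 * i.1 + 2 < Γ.level p) :
    Γ.pos i p = 0 := by
  rcases p with v | ⟨k | k | ⟨b, hb⟩, t, h0, h1⟩
  · simp only [level] at h
    exact if_neg (by omega)
  all_goals simp only [level] at h
  · have : i < k := by rw [Fin.lt_def]; omega
    simp [pos, posConst, posSlope, this.not_ge, this.ne']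
  · have : i < k := by rw [Fin.lt_def]; omega
    simp [pos, posConst, posSlope, this.not_ge, this.ne']
  · have : ¬b.1 < i.1 := by omega
    simp [pos, posConst, posSlope, this]

/-- The `i`-th component of the Abel–Jacobi map. -/
def aj (i : Fin g) : Γ.graph.Div →+ AddCircle (Γ.circ i) :=
  Finsupp.liftAddHom fun p => zmultiplesHom _ (Γ.pos i p : AddCircle (Γ.circ i))

@[simp] theorem aj_single (i : Fin g) (p : Γ.graph.Point) (m : ℤ) :
    Γ.aj i (Finsupp.single p m) = m • (Γ.pos i p : AddCircle (Γ.circ i)) := by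
  simp [aj]

theorem aj_eq_coe (i : Fin g) (D : Γ.graph.Div) :
    Γ.aj i D = ((D.sum fun p m => (m : ℝ) * Γ.pos i p : ℝ) : AddCircle (Γ.circ i)) := by
  simp only [aj, Finsupp.liftAddHom_apply, Finsupp.sum, zmultiplesHom_apply]
  refine Eq.trans ?_
    (map_sum (QuotientAddGroup.mk' (AddSubgroup.zmultiples (Γ.circ i))) _ _).symm
  refine Finset.sum_congr rfl fun p _ => ?_
  rw [← zsmul_eq_mul]; rfl

theorem deg_eq_sum (D : Γ.graph.Div) : Γ.graph.deg D = D.sum fun _ m => m := by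
  simp [MetricGraph.deg, Finsupp.sum]

@[simp] theorem deg_single (p : Γ.graph.Point) (m : ℤ) :
    Γ.graph.deg (Finsupp.single p m) = m := by
  simp [MetricGraph.deg]

theorem deg_eq_zero_of_mem_principal {D : Γ.graph.Div} (hD : D ∈ Γ.graph.principal) :
    Γ.graph.deg D = 0 := by
  obtain ⟨f, hf⟩ := hD
  have := MetricGraph.sum_principal f D hf (fun _ => 1) (fun _ => 1) (fun _ => 0) (by simp)
  simp only [mul_one, sub_self, zero_mul, add_zero,
    Finset.sum_const_zero] at this
  rw [deg_eq_sum]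
  rw [Finsupp.sum] at this ⊢
  exact_mod_cast this

/-- In the pairing with `pos i`, the increments of the function along the two sides of loop `i`
cancel, leaving an integer slope times the circumference. The other edges contribute nothing,
because `pos i` is constant along them. -/
theorem aj_eq_zero_of_mem_principal {D : Γ.graph.Div} (hD : D ∈ Γ.graph.principal) (i : Fin g) :
    Γ.aj i D = 0 := by
  obtain ⟨f, hf⟩ := hD
  rw [aj_eq_coe, MetricGraph.sum_principal f D hf (Γ.pos i) (Γ.posConst i) (Γ.posSlope i)
    (fun _ _ _ _ => rfl), sum_edge]
  have h1 : ∀ k : Fin g, (Γ.pos i (.vertex (Γ.graph.src (Γ.topE k))) - Γ.posConst i (Γ.topE k)) *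
      (f.fwd (Γ.topE k) 0 : ℝ) + (Γ.pos i (.vertex (Γ.graph.tgt (Γ.topE k))) -
        Γ.posConst i (Γ.topE k) - Γ.posSlope i (Γ.topE k) * Γ.graph.len (Γ.topE k)) *
        f.bwd (Γ.topE k) (Γ.graph.len (Γ.topE k)) - Γ.posSlope i (Γ.topE k) *
        (f.toFun (.vertex (Γ.graph.tgt (Γ.topE k))) -
          f.toFun (.vertex (Γ.graph.src (Γ.topE k)))) =
      if k = i then -Γ.circ i * f.bwd (Γ.topE i) (Γ.top i) -
        (f.toFun (.vertex (Γ.w i)) - f.toFun (.vertex (Γ.v i))) else 0 := by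
    intro k
    change (Γ.pos i (.vertex (Γ.v k)) - _) * _ + (Γ.pos i (.vertex (Γ.w k)) - _ - _ * Γ.top k) *
      (f.bwd (Γ.topE k) (Γ.top k) : ℝ) - _ * (f.toFun (.vertex (Γ.w k)) -
        f.toFun (.vertex (Γ.v k))) = _
    rw [pos_v, pos_w]
    rcases lt_trichotomy k i with h | h | h
    · simp [posConst, posSlope, topE, h, h.le, h.ne]
    · subst h
      simp only [posConst, posSlope, topE, circ, le_refl, if_true, lt_irrefl, if_false]
      ring
    · simp [posConst, posSlope, topE, h.not_ge, h.ne', h.not_gt]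
  have h2 : ∀ k : Fin g, (Γ.pos i (.vertex (Γ.graph.src (Γ.botE k))) - Γ.posConst i (Γ.botE k)) *
      (f.fwd (Γ.botE k) 0 : ℝ) + (Γ.pos i (.vertex (Γ.graph.tgt (Γ.botE k))) -
        Γ.posConst i (Γ.botE k) - Γ.posSlope i (Γ.botE k) * Γ.graph.len (Γ.botE k)) *
        f.bwd (Γ.botE k) (Γ.graph.len (Γ.botE k)) - Γ.posSlope i (Γ.botE k) *
        (f.toFun (.vertex (Γ.graph.tgt (Γ.botE k))) -
          f.toFun (.vertex (Γ.graph.src (Γ.botE k)))) =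
      if k = i then f.toFun (.vertex (Γ.w i)) - f.toFun (.vertex (Γ.v i)) else 0 := by
    intro k
    change (Γ.pos i (.vertex (Γ.v k)) - _) * _ + (Γ.pos i (.vertex (Γ.w k)) - _ - _ * Γ.bot k) *
      (f.bwd (Γ.botE k) (Γ.bot k) : ℝ) - _ * (f.toFun (.vertex (Γ.w k)) -
        f.toFun (.vertex (Γ.v k))) = _
    rw [pos_v, pos_w]
    rcases lt_trichotomy k i with h | h | h
    · simp [posConst, posSlope, botE, h, h.le, h.ne]
    · subst h
      simp [posConst, posSlope, botE]
    · simp [posConst, posSlope, botE, h.not_ge, h.ne', h.not_gt]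
  rw [Finset.sum_congr rfl fun k _ => h1 k, Finset.sum_congr rfl fun k _ => h2 k,
    Finset.sum_ite_eq', Finset.sum_ite_eq', if_pos (Finset.mem_univ _), if_pos (Finset.mem_univ _),
    Finset.sum_eq_zero, add_zero, sub_add_cancel]
  · rw [AddCircle.coe_eq_zero_iff]
    exact ⟨-f.bwd (Γ.topE i) (Γ.top i), by rw [zsmul_eq_mul]; push_cast; ring⟩
  · intro b _
    split_ifs with hb
    · change (Γ.pos i (.vertex (Γ.w ⟨b, _⟩)) - _) * _ + (Γ.pos i (.vertex (Γ.v ⟨b + 1, _⟩)) - _ -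
        _ * Γ.bridge b) * (f.bwd (Γ.bridgeE b hb) (Γ.bridge b) : ℝ) - _ * _ = 0
      rw [pos_v, pos_w]
      by_cases h : b.1 < i.1
      · simp [posConst, posSlope, bridgeE, h, Fin.lt_def, Fin.le_def]
      · simp [posConst, posSlope, bridgeE, h, Fin.lt_def, Fin.le_def]
    · rfl

/-- The degree of the restriction of a divisor to the points of level at most `n`. -/
def cumDeg (D : Γ.graph.Div) (n : ℕ) : ℤ := D.sum fun p m => if Γ.level p ≤ n then m else 0

/-- The degree of the restriction of a divisor to the points of level `n`. -/
def levelDeg (D : Γ.graph.Div) (n : ℕ) : ℤ := D.sum fun p m => if Γ.level p = n then m else 0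

/-- The degree of the restriction of a divisor to the interior of an edge. -/
def edgeDeg (D : Γ.graph.Div) (e : Γ.graph.E) : ℤ :=
  D.sum fun p m => m * before e (Γ.graph.len e) p

theorem cumDeg_succ (D : Γ.graph.Div) (n : ℕ) :
    Γ.cumDeg D (n + 1) = Γ.cumDeg D n + Γ.levelDeg D (n + 1) := by
  rw [cumDeg, cumDeg, levelDeg, ← Finsupp.sum_add]
  refine Finset.sum_congr rfl fun p _ => ?_
  dsimp only
  split_ifs <;> omega

theorem cumDeg_zero (D : Γ.graph.Div) : Γ.cumDeg D 0 = 0 :=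
  Finset.sum_eq_zero fun p _ => if_neg (by have := Γ.one_le_level p; omega)

theorem cumDeg_of_le (D : Γ.graph.Div) {n : ℕ} (h : 4 * g ≤ n + 1) :
    Γ.cumDeg D n = Γ.graph.deg D := by
  rw [deg_eq_sum]
  exact Finset.sum_congr rfl fun p _ => if_pos (by have := Γ.level_lt p; omega)

/-- Interior points have even level and distinct vertices have distinct levels, so an odd level
holds at most one point. -/
theorem levelDeg_vertexLevel (D : Γ.graph.Div) (q : Γ.graph.V) (hq : Γ.vertexLevel q % 2 = 1) :
    Γ.levelDeg D (Γ.vertexLevel q) = D (.vertex q) := by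
  classical
  have : ∀ p, (Γ.level p = Γ.vertexLevel q) ↔ p = .vertex q := by
    intro p
    constructor
    · rcases p with v | ⟨k | k | ⟨b, hb⟩, t, h0, h1⟩
      · intro h; rw [Γ.vertexLevel_injective h]
      all_goals simp only [level]; intro h; omega
    · rintro rfl; rfl
  rw [levelDeg, Finsupp.sum]
  simp only [this]
  rw [Finset.sum_ite_eq']
  split_ifs with h
  · rfl
  · exact (Finsupp.notMem_support_iff.1 h).symm

theorem vertexLevel_odd (q : Γ.graph.V) : Γ.vertexLevel q % 2 = 1 := by
  induction q using Γ.vertex_cases with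
  | hw i => rw [vertexLevel_w]; omega
  | hv i hi => rw [Γ.vertexLevel_v_of_not_isGlued hi]; omega

theorem before_of_ne {X : MetricGraph} {e e' : X.E} (h : e' ≠ e) (u : ℝ) {t : ℝ} {h0 : 0 < t}
    {h1 : t < X.len e'} : before e u (.interior e' t h0 h1) = 0 := if_neg fun h' => h h'.1

theorem before_self {X : MetricGraph} (e : X.E) {t : ℝ} {h0 : 0 < t}
    {h1 : t < X.len e} : before e (X.len e) (.interior e t h0 h1) = 1 := if_pos ⟨rfl, h1⟩

theorem ite_level_loop (p : Γ.graph.Point) (i : Fin g) :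
    (if Γ.level p = 4 * i.1 + 2 then (1 : ℤ) else 0) =
      before (Γ.topE i) (Γ.graph.len (Γ.topE i)) p +
        before (Γ.botE i) (Γ.graph.len (Γ.botE i)) p := by
  induction p using Γ.point_cases with
  | vertex v =>
    have h := Γ.vertexLevel_odd v
    rw [level_vertex, if_neg (by omega)]; rfl
  | top k t h0 h1 =>
    rw [level_topE, before_of_ne (Γ.topE_ne_botE k i)]
    by_cases h : k = i
    · subst h
      rw [if_pos rfl, before_self]; rfl
    · rw [if_neg (fun h' => h (Fin.ext (by omega))), before_of_ne (mt Γ.topE_inj.1 h)]; rfl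
  | bot k t h0 h1 =>
    rw [level_botE, before_of_ne (Γ.topE_ne_botE i k).symm]
    by_cases h : k = i
    · subst h
      rw [if_pos rfl, before_self]; rfl
    · rw [if_neg (fun h' => h (Fin.ext (by omega))), before_of_ne (mt Γ.botE_inj.1 h)]; rfl
  | bridge b hb t h0 h1 =>
    rw [level_bridgeE, if_neg (by omega), before_of_ne (Γ.topE_ne_bridgeE i b hb).symm,
      before_of_ne (Γ.botE_ne_bridgeE i b hb).symm]; rfl

theorem ite_level_bridge (p : Γ.graph.Point) (b : Fin (g - 1)) (hb : 0 < Γ.bridge b) :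
    (if Γ.level p = 4 * b.1 + 4 then (1 : ℤ) else 0) =
      before (Γ.bridgeE b hb) (Γ.graph.len (Γ.bridgeE b hb)) p := by
  induction p using Γ.point_cases with
  | vertex v =>
    have h := Γ.vertexLevel_odd v
    rw [level_vertex, if_neg (by omega)]; rfl
  | top k t h0 h1 =>
    rw [level_topE, before_of_ne (Γ.topE_ne_bridgeE k b hb), if_neg (by omega)]
  | bot k t h0 h1 =>
    rw [level_botE, before_of_ne (Γ.botE_ne_bridgeE k b hb), if_neg (by omega)]
  | bridge b' hb' t h0 h1 =>
    rw [level_bridgeE]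
    by_cases h : b' = b
    · subst h
      rw [if_pos rfl, before_self]
    · rw [if_neg (fun h' => h (Fin.ext (by omega))), before_of_ne (mt Γ.bridgeE_inj.1 h)]

theorem levelDeg_loop (D : Γ.graph.Div) (i : Fin g) :
    Γ.levelDeg D (4 * i.1 + 2) = Γ.edgeDeg D (Γ.topE i) + Γ.edgeDeg D (Γ.botE i) := by
  rw [levelDeg, edgeDeg.eq_def, edgeDeg.eq_def, ← Finsupp.sum_add]
  refine Finset.sum_congr rfl fun p _ => ?_
  dsimp only
  rw [← mul_add, ← ite_level_loop, mul_ite, mul_one, mul_zero]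

theorem levelDeg_bridge (D : Γ.graph.Div) (b : Fin (g - 1)) (hb : 0 < Γ.bridge b) :
    Γ.levelDeg D (4 * b.1 + 4) = Γ.edgeDeg D (Γ.bridgeE b hb) := by
  refine Finset.sum_congr rfl fun p _ => ?_
  dsimp only
  rw [← ite_level_bridge, mul_ite, mul_one, mul_zero]

/-- When `v_i` is glued there is no bridge at level `4i` and no vertex at level `4i + 1`. -/
theorem cumDeg_of_isGlued (D : Γ.graph.Div) {i : Fin g} (h : Γ.IsGlued i) :
    Γ.cumDeg D (4 * i.1 + 1) = Γ.cumDeg D (4 * i.1 - 1) := by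
  obtain ⟨b, hb, hz⟩ := id h
  refine Finset.sum_congr rfl fun p _ => ?_
  have : Γ.level p ≤ 4 * i.1 + 1 ↔ Γ.level p ≤ 4 * i.1 - 1 := by
    refine ⟨fun hp => ?_, fun hp => by omega⟩
    rcases p with v | ⟨k | k | ⟨b', hb'⟩, t, h0, h1⟩
    · induction v using Γ.vertex_cases with
      | hw k => simp only [level, vertexLevel_w] at *; omega
      | hv k hk =>
        simp only [level, Γ.vertexLevel_v_of_not_isGlued hk] at *
        have : k ≠ i := by rintro rfl; exact hk ⟨b, hb, hz⟩
        have : k.1 ≠ i.1 := fun h => this (Fin.ext h)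
        omega
    · simp only [level] at *; omega
    · simp only [level] at *; omega
    · simp only [level] at *
      have : b' ≠ b := by rintro rfl; exact hb'.ne' hz
      have : b'.1 ≠ b.1 := fun h => this (Fin.ext h)
      omega
  simp only [this]

theorem cumDeg_vertexLevel_v (D : Γ.graph.Div) (i : Fin g) :
    Γ.cumDeg D (Γ.vertexLevel (Γ.v i)) = Γ.cumDeg D (4 * i.1 + 1) := by
  by_cases h : Γ.IsGlued i
  · rw [Γ.vertexLevel_v_of_isGlued h, Γ.cumDeg_of_isGlued D h]
  · rw [Γ.vertexLevel_v_of_not_isGlued h]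

theorem v_eq_w_iff (i k : Fin g) :
    Γ.v i = Γ.w k ↔ ∃ b : Fin (g - 1), b.1 + 1 = i.1 ∧ b.1 = k.1 ∧ Γ.bridge b = 0 := by
  constructor
  · intro h
    by_cases hi : Γ.IsGlued i
    · have := congrArg Γ.vertexLevel h
      rw [Γ.vertexLevel_v_of_isGlued hi, vertexLevel_w] at this
      obtain ⟨b, hb, h⟩ := hi
      exact ⟨b, hb, by omega, h⟩
    · have := congrArg Γ.vertexLevel h
      rw [Γ.vertexLevel_v_of_not_isGlued hi, vertexLevel_w] at this
      omega
  · rintro ⟨b, hb, hk, h⟩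
    rw [Γ.v_eq_w hb h]
    congr 1; ext; exact hk

theorem v_injective : Function.Injective Γ.v := by
  intro i k h
  have h1 := (Γ.vertexLevel_v_le_iff i k).1
  have h2 := (Γ.vertexLevel_v_le_iff k i).1
  have h3 := (Γ.vertexLevel_v_le_iff i i).2 le_rfl
  have h4 := (Γ.vertexLevel_v_le_iff k k).2 le_rfl
  rw [h] at h2 h3
  exact le_antisymm (h2 h4) (h1 h3)

theorem w_injective : Function.Injective Γ.w := by
  intro i k h
  have := congrArg Γ.vertexLevel h
  simp only [vertexLevel_w] at this
  ext; omega

open Classical in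
/-- Flow conservation at a vertex for slopes given by cumulative degrees. -/
theorem sum_src {D : Γ.graph.Div} (hD : Γ.graph.deg D = 0) (s : Γ.graph.E → ℤ)
    (hs : ∀ i, s (Γ.topE i) + s (Γ.botE i) = Γ.cumDeg D (4 * i.1 + 1))
    (hb : ∀ b h, s (Γ.bridgeE b h) = Γ.cumDeg D (4 * b.1 + 3)) (q : Γ.graph.V) :
    (∑ e, if Γ.graph.src e = q then s e else 0) = Γ.cumDeg D (Γ.vertexLevel q) := by
  rw [sum_edge, ← Finset.sum_add_distrib]
  have h1 : ∀ i, ((if Γ.graph.src (Γ.topE i) = q then s (Γ.topE i) else 0) +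
      if Γ.graph.src (Γ.botE i) = q then s (Γ.botE i) else 0) =
      if Γ.v i = q then Γ.cumDeg D (4 * i.1 + 1) else 0 := by
    intro i
    change ((if Γ.v i = q then _ else _) + if Γ.v i = q then _ else _) = _
    rw [← hs]; split_ifs <;> simp
  have h2 : ∀ b, (if h : 0 < Γ.bridge b then
      (if Γ.graph.src (Γ.bridgeE b h) = q then s (Γ.bridgeE b h) else 0) else 0) =
      if 0 < Γ.bridge b ∧ Γ.w ⟨b, by omega⟩ = q then Γ.cumDeg D (4 * b.1 + 3) else 0 := by
    intro b
    by_cases h : 0 < Γ.bridge b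
    · rw [dif_pos h, hb]
      simp only [h, true_and]; rfl
    · simp [h]
  rw [Finset.sum_congr rfl fun i _ => h1 i, Finset.sum_congr rfl fun b _ => h2 b]
  have hv : ∀ i, q = Γ.v i → (∑ i, if Γ.v i = q then Γ.cumDeg D (4 * i.1 + 1) else 0) +
      (∑ b : Fin (g - 1), if 0 < Γ.bridge b ∧ Γ.w ⟨b, by omega⟩ = q then
        Γ.cumDeg D (4 * b.1 + 3) else 0) = Γ.cumDeg D (Γ.vertexLevel q) := by
    rintro i rfl
    rw [Finset.sum_eq_single i, if_pos rfl, Finset.sum_eq_zero, cumDeg_vertexLevel_v, add_zero]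
    · intro b _
      refine if_neg ?_
      rintro ⟨h, h'⟩
      obtain ⟨b', -, h2, h3⟩ := (Γ.v_eq_w_iff _ _).1 h'.symm
      obtain rfl : b' = b := Fin.ext h2
      exact h.ne' h3
    · intro k _ hk
      exact if_neg fun h => hk (Γ.v_injective h)
    · simp
  induction q using Γ.vertex_cases with
  | hv i hi => exact hv i rfl
  | hw i =>
    by_cases hi : i.1 + 1 < g
    · let b : Fin (g - 1) := ⟨i, by omega⟩
      rcases (Γ.bridge_nonneg b).eq_or_lt with h | h
      · exact hv ⟨i + 1, hi⟩ ((Γ.v_eq_w_iff _ _).2 ⟨b, rfl, rfl, h.symm⟩).symm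
      · rw [Finset.sum_eq_zero, Finset.sum_eq_single b, if_pos ⟨h, rfl⟩, zero_add]
        · rfl
        · rintro b' - hb'
          refine if_neg fun h' => hb' ?_
          have := Γ.w_injective h'.2
          simp only [Fin.ext_iff] at this
          exact Fin.ext this
        · simp
        · intro k _
          refine if_neg fun h' => ?_
          obtain ⟨b', h1, h2, h3⟩ := (Γ.v_eq_w_iff _ _).1 h'
          obtain rfl : b' = b := Fin.ext h2
          exact h.ne' h3
    -- No edge starts at the last vertex; this is consistent only because the total degree is zero.
    · rw [Finset.sum_eq_zero, Finset.sum_eq_zero, Γ.cumDeg_of_le D, hD, add_zero]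
      · rw [vertexLevel_w]; omega
      · intro b _
        refine if_neg fun h' => ?_
        have := Γ.w_injective h'.2
        simp only [Fin.ext_iff] at this
        omega
      · intro k _
        refine if_neg fun h' => ?_
        obtain ⟨b', h1, h2, h3⟩ := (Γ.v_eq_w_iff _ _).1 h'
        omega

-- The slope at the end of an edge is the initial slope plus the chips in its interior, so the flow
-- arriving at a vertex counts the chips of strictly lower level. Subtracting this from `sum_src`
-- leaves the coefficient of the vertex.
open Classical in
theorem sum_tgt (D : Γ.graph.Div) (s : Γ.graph.E → ℤ)
    (hs : ∀ i, s (Γ.topE i) + s (Γ.botE i) = Γ.cumDeg D (4 * i.1 + 1))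
    (hb : ∀ b h, s (Γ.bridgeE b h) = Γ.cumDeg D (4 * b.1 + 3)) (q : Γ.graph.V) :
    (∑ e, if Γ.graph.tgt e = q then s e + Γ.edgeDeg D e else 0) =
      Γ.cumDeg D (Γ.vertexLevel q - 1) := by
  rw [sum_edge, ← Finset.sum_add_distrib]
  have h1 : ∀ i, ((if Γ.graph.tgt (Γ.topE i) = q then
        s (Γ.topE i) + Γ.edgeDeg D (Γ.topE i) else 0) +
      if Γ.graph.tgt (Γ.botE i) = q then s (Γ.botE i) + Γ.edgeDeg D (Γ.botE i) else 0) =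
      if Γ.w i = q then Γ.cumDeg D (4 * i.1 + 2) else 0 := by
    intro i
    change ((if Γ.w i = q then _ else _) + if Γ.w i = q then _ else _) = _
    rw [cumDeg_succ, ← hs, levelDeg_loop]
    split_ifs <;> ring
  have h2 : ∀ b, (if h : 0 < Γ.bridge b then
      (if Γ.graph.tgt (Γ.bridgeE b h) = q then
        s (Γ.bridgeE b h) + Γ.edgeDeg D (Γ.bridgeE b h) else 0) else 0) =
      if 0 < Γ.bridge b ∧ Γ.v ⟨b + 1, by omega⟩ = q then Γ.cumDeg D (4 * b.1 + 4) else 0 := by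
    intro b
    by_cases h : 0 < Γ.bridge b
    · rw [dif_pos h, hb, Γ.cumDeg_succ D (4 * b.1 + 3), Γ.levelDeg_bridge D b h]
      simp only [h, true_and]; rfl
    · simp [h]
  rw [Finset.sum_congr rfl fun i _ => h1 i, Finset.sum_congr rfl fun b _ => h2 b]
  induction q using Γ.vertex_cases with
  | hw i =>
    rw [Finset.sum_eq_single i, if_pos rfl, Finset.sum_eq_zero, add_zero]
    · rfl
    · intro b _
      refine if_neg ?_
      rintro ⟨h, h'⟩
      obtain ⟨b', h1, -, h3⟩ := (Γ.v_eq_w_iff _ _).1 h'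
      obtain rfl : b' = b := Fin.ext (by simpa using h1)
      exact h.ne' h3
    · intro k _ hk
      exact if_neg fun h => hk (Γ.w_injective h)
    · simp
  | hv i hi =>
    rw [Finset.sum_eq_zero, zero_add, Γ.vertexLevel_v_of_not_isGlued hi]
    · by_cases h0 : i.1 = 0
      · rw [Finset.sum_eq_zero, h0, cumDeg_zero]
        intro b _
        refine if_neg fun h' => ?_
        have := Γ.v_injective h'.2
        simp only [Fin.ext_iff] at this
        omega
      · let b : Fin (g - 1) := ⟨i - 1, by omega⟩
        have hbi : b.1 + 1 = i.1 := by simp only [b]; omega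
        have hb0 : 0 < Γ.bridge b := (Γ.bridge_nonneg b).lt_of_ne fun h => hi ⟨b, hbi, h.symm⟩
        have e : (⟨b.1 + 1, by omega⟩ : Fin g) = i := Fin.ext hbi
        rw [Finset.sum_eq_single b, if_pos ⟨hb0, by rw [e]⟩]
        · congr 1; omega
        · rintro b' - hb'
          refine if_neg fun h' => hb' ?_
          have := Γ.v_injective h'.2
          simp only [Fin.ext_iff] at this
          exact Fin.ext (by omega)
        · simp
    · intro k _
      refine if_neg fun h' => hi ?_
      obtain ⟨b, h1, h2, h3⟩ := (Γ.v_eq_w_iff _ _).1 h'.symm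
      exact ⟨b, h1, h3⟩

theorem ramp_of_ne {X : MetricGraph} {e e' : X.E} (h : e' ≠ e) (u : ℝ) {t : ℝ} {h0 : 0 < t}
    {h1 : t < X.len e'} : ramp e u (.interior e' t h0 h1) = 0 := if_neg h

theorem ramp_self {X : MetricGraph} (e : X.E) {t : ℝ} {h0 : 0 < t}
    {h1 : t < X.len e} : ramp e (X.len e) (.interior e t h0 h1) = X.len e - t :=
  (if_pos rfl).trans (max_eq_right (by linarith))

/-- This writes the position in terms of the quantities that govern slopes and increments of a
rational function. Summed over a divisor, it turns the vanishing of `aj i` into the condition that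
both sides of loop `i` give the same increment. -/
theorem pos_eq (i : Fin g) (p : Γ.graph.Point) :
    Γ.pos i p = Γ.bot i * (if Γ.level p ≤ 4 * i.1 + 1 then (1 : ℤ) else 0 : ℤ) +
      (Γ.circ i * before (Γ.topE i) (Γ.graph.len (Γ.topE i)) p -
        ramp (Γ.topE i) (Γ.graph.len (Γ.topE i)) p) +
      ramp (Γ.botE i) (Γ.graph.len (Γ.botE i)) p := by
  by_cases h1 : Γ.level p ≤ 4 * i.1 + 1
  · rw [Γ.pos_of_level_le h1, if_pos h1]
    induction p using Γ.point_cases with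
    | vertex v => simp [ramp, before]
    | top k t h0 h =>
      rw [level_topE] at h1
      have hk : k ≠ i := by rintro rfl; omega
      rw [before_of_ne (mt Γ.topE_inj.1 hk), ramp_of_ne (mt Γ.topE_inj.1 hk),
        ramp_of_ne (Γ.topE_ne_botE k i)]
      simp
    | bot k t h0 h =>
      rw [level_botE] at h1
      have hk : k ≠ i := by rintro rfl; omega
      rw [before_of_ne (Γ.topE_ne_botE i k).symm, ramp_of_ne (mt Γ.botE_inj.1 hk),
        ramp_of_ne (Γ.topE_ne_botE i k).symm]
      simp
    | bridge b hb t h0 h =>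
      rw [before_of_ne (Γ.topE_ne_bridgeE i b hb).symm,
        ramp_of_ne (Γ.botE_ne_bridgeE i b hb).symm, ramp_of_ne (Γ.topE_ne_bridgeE i b hb).symm]
      simp
  · rw [if_neg h1]
    induction p using Γ.point_cases with
    | vertex v =>
      have : Γ.pos i (.vertex v) = 0 := if_neg h1
      simp [ramp, before, this]
    | top k t h0 h =>
      rw [level_topE] at h1
      rw [ramp_of_ne (Γ.topE_ne_botE k i)]
      by_cases hk : k = i
      · subst hk
        rw [before_self, ramp_self, len_topE]
        simp [pos, posConst, posSlope, topE, circ]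
        ring
      · have : k.1 ≠ i.1 := fun h => hk (Fin.ext h)
        rw [before_of_ne (mt Γ.topE_inj.1 hk), ramp_of_ne (mt Γ.topE_inj.1 hk),
          Γ.pos_of_lt_level (by rw [level_topE]; omega)]
        simp
    | bot k t h0 h =>
      rw [level_botE] at h1
      rw [before_of_ne (Γ.topE_ne_botE i k).symm, ramp_of_ne (Γ.topE_ne_botE i k).symm]
      by_cases hk : k = i
      · subst hk
        rw [ramp_self, len_botE]
        simp [pos, posConst, posSlope, botE]
        ring
      · have : k.1 ≠ i.1 := fun h => hk (Fin.ext h)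
        rw [ramp_of_ne (mt Γ.botE_inj.1 hk), Γ.pos_of_lt_level (by rw [level_botE]; omega)]
        simp
    | bridge b hb t h0 h =>
      rw [level_bridgeE] at h1
      rw [before_of_ne (Γ.topE_ne_bridgeE i b hb).symm,
        ramp_of_ne (Γ.botE_ne_bridgeE i b hb).symm, ramp_of_ne (Γ.topE_ne_bridgeE i b hb).symm,
        Γ.pos_of_lt_level (by rw [level_bridgeE]; omega)]
      simp

/-- The total contribution of the interior of an edge to the increase of a function along it. -/
def edgeRamp (D : Γ.graph.Div) (e : Γ.graph.E) : ℝ :=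
  D.sum fun p m => (m : ℝ) * ramp e (Γ.graph.len e) p

theorem sum_pos_eq (D : Γ.graph.Div) (i : Fin g) :
    (D.sum fun p m => (m : ℝ) * Γ.pos i p) = Γ.bot i * Γ.cumDeg D (4 * i.1 + 1) +
      (Γ.circ i * Γ.edgeDeg D (Γ.topE i) - Γ.edgeRamp D (Γ.topE i)) +
      Γ.edgeRamp D (Γ.botE i) := by
  unfold cumDeg edgeDeg edgeRamp
  simp only [Finsupp.sum]
  push_cast
  rw [Finset.mul_sum, Finset.mul_sum, ← Finset.sum_sub_distrib, ← Finset.sum_add_distrib,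
    ← Finset.sum_add_distrib]
  refine Finset.sum_congr rfl fun p _ => ?_
  rw [pos_eq]
  split_ifs <;> push_cast <;> ring

theorem sum_ite_le_succ {ι : Type*} [Fintype ι] (F : ι → ℝ) (l : ι → ℕ) (n : ℕ) :
    (∑ i, if l i ≤ n + 1 then F i else 0) =
      (∑ i, if l i ≤ n then F i else 0) + ∑ i, if l i = n + 1 then F i else 0 := by
  rw [← Finset.sum_add_distrib]
  refine Finset.sum_congr rfl fun i _ => ?_
  split_ifs <;> first | omega | ring

/-- Existence of a function of the level with prescribed increments along loops and bridges. -/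
theorem exists_potential (a : Fin g → ℝ) (b : Fin (g - 1) → ℝ)
    (hb : ∀ k, Γ.bridge k = 0 → b k = 0) :
    ∃ Φ : Γ.graph.V → ℝ, (∀ i, Φ (Γ.w i) = Φ (Γ.v i) + a i) ∧
      ∀ k : Fin (g - 1), Φ (Γ.v ⟨k + 1, by omega⟩) = Φ (Γ.w ⟨k, by omega⟩) + b k := by
  -- `P n` collects the increments at the even levels up to `n`. The potential of a vertex is `P` at
  -- its level; `hb` makes this agree at glued vertices.
  let P : ℕ → ℝ := fun n => (∑ i : Fin g, if 4 * i.1 + 2 ≤ n then a i else 0) +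
    ∑ k : Fin (g - 1), if 4 * k.1 + 4 ≤ n then b k else 0
  have hP : ∀ n, P (n + 1) = P n + ((∑ i : Fin g, if 4 * i.1 + 2 = n + 1 then a i else 0) +
      ∑ k : Fin (g - 1), if 4 * k.1 + 4 = n + 1 then b k else 0) := by
    intro n
    simp only [P]
    rw [sum_ite_le_succ, sum_ite_le_succ]; ring
  have hodd : ∀ n, n % 2 = 0 → P (n + 1) = P n := by
    intro n hn
    rw [hP, Finset.sum_eq_zero, Finset.sum_eq_zero, add_zero, add_zero]
    · exact fun k _ => if_neg (by omega)
    · exact fun k _ => if_neg (by omega)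
  have h2 : ∀ i : Fin g, P (4 * i.1 + 3) = P (4 * i.1 + 1) + a i := by
    intro i
    rw [hodd _ (by omega), hP, Finset.sum_eq_single i, if_pos rfl, Finset.sum_eq_zero, add_zero]
    · exact fun k _ => if_neg (by omega)
    · exact fun k _ hk => if_neg fun h => hk (Fin.ext (by omega))
    · simp
  have h4 : ∀ k : Fin (g - 1), P (4 * k.1 + 5) = P (4 * k.1 + 3) + b k := by
    intro k
    rw [hodd _ (by omega), hP, Finset.sum_eq_zero, Finset.sum_eq_single k, if_pos rfl, zero_add]
    · exact fun j _ hj => if_neg fun h => hj (Fin.ext (by omega))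
    · simp
    · exact fun k _ => if_neg (by omega)
  have hv : ∀ i, P (Γ.vertexLevel (Γ.v i)) = P (4 * i.1 + 1) := by
    intro i
    by_cases h : Γ.IsGlued i
    · rw [Γ.vertexLevel_v_of_isGlued h]
      obtain ⟨k, hk, h⟩ := h
      have := h4 k
      rw [hb k h, add_zero] at this
      rw [show 4 * i.1 - 1 = 4 * k.1 + 3 by omega, show 4 * i.1 + 1 = 4 * k.1 + 5 by omega, this]
    · rw [Γ.vertexLevel_v_of_not_isGlued h]
  refine ⟨fun q => P (Γ.vertexLevel q), fun i => ?_, fun k => ?_⟩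
  · change P (Γ.vertexLevel (Γ.w i)) = P (Γ.vertexLevel (Γ.v i)) + a i
    rw [hv, vertexLevel_w, h2]
  · change P (Γ.vertexLevel (Γ.v _)) = P (Γ.vertexLevel (Γ.w _)) + b k
    rw [hv, vertexLevel_w]; exact h4 k

/-- The Abel–Jacobi theorem for a chain of loops. -/
theorem mem_principal_iff (D : Γ.graph.Div) :
    D ∈ Γ.graph.principal ↔ Γ.graph.deg D = 0 ∧ ∀ i, Γ.aj i D = 0 := by
  classical
  refine ⟨fun h => ⟨Γ.deg_eq_zero_of_mem_principal h, Γ.aj_eq_zero_of_mem_principal h⟩, ?_⟩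
  rintro ⟨hdeg, haj⟩
  have : ∀ i, ∃ A : ℤ, A * Γ.circ i = D.sum fun p m => (m : ℝ) * Γ.pos i p := by
    intro i
    have := haj i
    rw [aj_eq_coe, AddCircle.coe_eq_zero_iff] at this
    obtain ⟨A, hA⟩ := this
    exact ⟨A, by rw [← hA, zsmul_eq_mul]⟩
  choose A hA using this
  -- The integer `A i` is the slope with which the function must arrive at `w_i` along the top
  -- segment, as the proof of `aj_eq_zero_of_mem_principal` shows. The slopes on the bottom segment
  -- and on the bridges are then forced by flow conservation.
  let s : Γ.graph.E → ℤ
    | Edge.top i => A i - Γ.edgeDeg D (Γ.topE i)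
    | Edge.bot i => Γ.cumDeg D (4 * i.1 + 1) - (A i - Γ.edgeDeg D (Γ.topE i))
    | Edge.bridge b _ => Γ.cumDeg D (4 * b.1 + 3)
  have slope_top : ∀ i, s (Γ.topE i) = A i - Γ.edgeDeg D (Γ.topE i) := fun _ => rfl
  have slope_bot : ∀ i, s (Γ.botE i) = Γ.cumDeg D (4 * i.1 + 1) - (A i - Γ.edgeDeg D (Γ.topE i)) :=
    fun _ => rfl
  obtain ⟨Φ, hΦ, hΦ'⟩ := Γ.exists_potential
    (fun i => s (Γ.topE i) * Γ.top i + Γ.edgeRamp D (Γ.topE i))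
    (fun b => if h : 0 < Γ.bridge b then
      s (Γ.bridgeE b h) * Γ.bridge b + Γ.edgeRamp D (Γ.bridgeE b h) else 0)
    (fun k hk => dif_neg hk.not_gt)
  have hs : ∀ i, s (Γ.topE i) + s (Γ.botE i) = Γ.cumDeg D (4 * i.1 + 1) := by
    intro i; rw [slope_top, slope_bot]; ring
  refine mem_principal_of_slopes D s Φ ?_ ?_
  · rintro (i | i | ⟨b, h⟩)
    · exact (hΦ i).trans (add_assoc _ _ _).symm
    · refine (hΦ i).trans ?_
      change _ = Φ (Γ.v i) + s (Γ.botE i) * Γ.bot i + Γ.edgeRamp D (Γ.botE i)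
      have := hA i
      rw [sum_pos_eq, circ] at this
      simp only [slope_top, slope_bot]
      push_cast
      linear_combination this
    · refine (hΦ' b).trans ?_
      rw [dif_pos h]
      exact (add_assoc _ _ _).symm
  · intro q
    have h1 := Γ.sum_src hdeg s hs (fun _ _ => rfl) q
    have h2 := Γ.sum_tgt D s hs (fun _ _ => rfl) q
    have h3 := Γ.cumDeg_succ D (Γ.vertexLevel q - 1)
    rw [Nat.sub_add_cancel (Γ.one_le_vertexLevel q),
      Γ.levelDeg_vertexLevel D q (Γ.vertexLevel_odd q)] at h3
    refine Eq.trans (congrArg₂ _ ?_ ?_) (sub_eq_iff_eq_add'.2 h3)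
    · convert h1
    · convert h2; rfl

theorem linEquiv_iff (D D' : Γ.graph.Div) : Γ.graph.LinEquiv D D' ↔
    Γ.graph.deg D = Γ.graph.deg D' ∧ ∀ i, Γ.aj i D = Γ.aj i D' := by
  simp only [LinEquiv, mem_principal_iff, map_sub, sub_eq_zero]

theorem toPic0_eq_iff (D D' : Γ.graph.Div0) :
    Γ.graph.toPic0 D = Γ.graph.toPic0 D' ↔ ∀ i, Γ.aj i D = Γ.aj i D' := by
  have h : Γ.graph.toPic0 D = Γ.graph.toPic0 D' ↔ Γ.graph.LinEquiv (D' : Γ.graph.Div) D := by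
    refine QuotientAddGroup.eq.trans ?_
    rw [AddSubgroup.mem_addSubgroupOf, LinEquiv, sub_eq_neg_add]
    rfl
  rw [h, linEquiv_iff, (AddMonoidHom.mem_ker).1 D.2, (AddMonoidHom.mem_ker).1 D'.2]
  simp only [true_and]
  exact forall_congr' fun i => eq_comm

theorem pos_loopPoint (i k : Fin g) (z : ℝ) :
    (Γ.pos k (Γ.loopPoint i z) : AddCircle (Γ.circ k)) =
      if i < k then (Γ.bot k : AddCircle (Γ.circ k)) else if k < i then 0 else (z : ℝ) := by
  have hc := Γ.circ_pos i
  set s := toIcoMod hc 0 z with hs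
  have hs0 : 0 ≤ s := left_le_toIcoMod hc 0 z
  have hsc : s < Γ.circ i := by simpa using toIcoMod_lt_right hc 0 z
  have hsz : ((s : ℝ) : AddCircle (Γ.circ i)) = (z : ℝ) := by
    rw [hs, toIcoMod]
    rw [AddCircle.coe_sub, sub_eq_self, AddCircle.coe_eq_zero_iff]
    exact ⟨_, rfl⟩
  have hl : Γ.loopPoint i z = if s ≤ Γ.bot i then Γ.graph.pt (Γ.botE i) (Γ.bot i - s)
    else Γ.graph.pt (Γ.topE i) (s - Γ.bot i) := rfl
  have key : ∃ y : ℝ, (y : AddCircle (Γ.circ i)) = (s : ℝ) ∧ Γ.pos k (Γ.loopPoint i z) =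
      if i < k then Γ.bot k else if k < i then 0 else y := by
    rw [hl]
    by_cases h : s ≤ Γ.bot i
    · rw [if_pos h]
      rcases hs0.eq_or_lt with h0 | h0
      · rw [← h0, sub_zero, ← len_botE, pt_len, tgt_botE, pos_w]
        refine ⟨0, rfl, ?_⟩
        split_ifs <;> rfl
      rcases h.eq_or_lt with h1 | h1
      · rw [h1, sub_self, pt_zero, src_botE, pos_v]
        refine ⟨Γ.bot i, rfl, ?_⟩
        rcases lt_trichotomy i k with h | h | h
        · simp [h, h.le]
        · subst h; simp
        · simp [h, h.not_ge, h.not_gt]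
      · rw [pt_interior (Γ.botE i) (by linarith) (by rw [len_botE]; linarith)]
        refine ⟨s, rfl, ?_⟩
        rcases lt_trichotomy i k with h | h | h
        · simp [pos, posConst, posSlope, botE, h, h.le, h.ne]
        · subst h; simp [pos, posConst, posSlope, botE]
        · simp [pos, posConst, posSlope, botE, h, h.not_ge, h.not_gt, h.ne']
    · rw [if_neg h, pt_interior (Γ.topE i) (by linarith) (by rw [len_topE]; unfold circ at hsc; linarith)]
      refine ⟨s, rfl, ?_⟩
      rcases lt_trichotomy i k with h | h | h
      · simp [pos, posConst, posSlope, topE, h, h.le, h.ne]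
      · subst h; simp [pos, posConst, posSlope, topE]
      · simp [pos, posConst, posSlope, topE, h, h.not_ge, h.not_gt, h.ne']
  obtain ⟨y, hy, hk⟩ := key
  rw [hk]
  rcases lt_trichotomy i k with h | h | h
  · simp [h]
  · subst h; simp only [lt_irrefl, if_false]; rw [hy, hsz]
  · simp [h, h.not_gt]

theorem sum_fin_lt_sub (J : ℕ → ℤ) (k : ℕ) (hk : k ≤ g) :
    (∑ i : Fin g, if i.1 < k then J (i.1 + 1) - J i.1 else 0) = J k - J 0 := by
  rw [Fin.sum_univ_eq_sum_range (fun i => if i < k then J (i + 1) - J i else 0) g,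
    ← Finset.sum_range_sub J k, ← Finset.sum_filter]
  refine Finset.sum_congr ?_ fun _ _ => rfl
  ext i
  simp only [Finset.mem_filter, Finset.mem_range]
  omega

theorem pos_lastPoint (k : Fin g) : Γ.pos k Γ.lastPoint = 0 := by
  rw [lastPoint, pos_w, if_neg]
  rw [Fin.lt_def]
  dsimp only
  omega

/-- Each of the `k` chips on earlier loops retracts to `v_k`, at position `bot k`; chips on later
loops and at `w_g` retract to position zero. -/
theorem aj_coordDiv (x : Fin g → ℝ) (k : Fin g) :
    Γ.aj k (Γ.coordDiv x : Γ.graph.Div) =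
      (x k : AddCircle (Γ.circ k)) + (k.1 : ℤ) • (Γ.bot k : AddCircle (Γ.circ k)) := by
  rw [coordDiv, map_sub, map_sum, map_zsmul, aj_single, pos_lastPoint]
  simp only [aj_single, one_smul, pos_loopPoint]
  have h : ∀ i, (if i < k then (Γ.bot k : AddCircle (Γ.circ k)) else if k < i then 0 else
      ((x i : ℝ) : AddCircle (Γ.circ k))) = (if i = k then (x k : AddCircle (Γ.circ k)) else 0) +
        (if i.1 < k.1 then ((i.1 + 1 : ℕ) : ℤ) - (i.1 : ℕ) else 0 : ℤ) •
          (Γ.bot k : AddCircle (Γ.circ k)) := by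
    intro i
    rcases lt_trichotomy i k with h | h | h
    · simp [h, h.ne, Fin.lt_def.1 h]
    · subst h; simp
    · simp [h, h.not_gt, h.ne']
  rw [Finset.sum_congr rfl fun i _ => h i, Finset.sum_add_distrib, ← Finset.sum_smul,
    sum_fin_lt_sub (fun n => (n : ℤ)) k.1 k.2.le]
  simp

/-! ### Effective classes in terms of chip numbers -/

/-- The combinatorial form of effectiveness of a divisor class of degree `m`: `J i` chips lie to
the left of the `i`-th loop. -/
def IsEffective (m : ℕ) (a : ∀ i, AddCircle (Γ.circ i)) : Prop :=
  ∃ J : ℕ → ℕ, Monotone J ∧ J 0 = 0 ∧ J g ≤ m ∧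
    ∀ i : Fin g, J (i + 1) = J i → a i = (J i : ℤ) • (Γ.bot i : AddCircle (Γ.circ i))

theorem cumDeg_mono {F : Γ.graph.Div} (hF : 0 ≤ F) : Monotone (Γ.cumDeg F) := by
  intro m n hmn
  refine Finset.sum_le_sum fun p _ => ?_
  have := hF p
  simp only [Finsupp.coe_zero, Pi.zero_apply] at this
  dsimp only
  split_ifs <;> omega

/-- Let `J n` count the chips of level at most `4 * n`. If loop `i` contributes none, all chips
retract to `v_i` or `w_i`, and only those on the left contribute, each by `bot i`. -/
theorem isEffective_of_effective {F : Γ.graph.Div} (hF : 0 ≤ F) {m : ℕ}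
    (hm : Γ.graph.deg F = m) : Γ.IsEffective m fun i => Γ.aj i F := by
  have h0 : ∀ n, 0 ≤ Γ.cumDeg F n := fun n => by
    have := Γ.cumDeg_mono hF (Nat.zero_le n)
    rwa [cumDeg_zero] at this
  refine ⟨fun n => (Γ.cumDeg F (4 * n)).toNat, ?_, ?_, ?_, ?_⟩
  · intro a b hab
    exact Int.toNat_le_toNat (Γ.cumDeg_mono hF (by omega))
  · simp [cumDeg_zero]
  · dsimp only
    rw [Γ.cumDeg_of_le F (by omega), hm]; simp
  · intro i hi
    dsimp only at hi ⊢
    rw [Int.toNat_of_nonneg (h0 _)]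
    have hi : Γ.cumDeg F (4 * (i.1 + 1)) - Γ.cumDeg F (4 * i.1) = 0 := by
      have h1 := h0 (4 * (i.1 + 1)); have h2 := h0 (4 * i.1)
      omega
    have hsub : ∀ p ∈ F.support, (if Γ.level p ≤ 4 * (i.1 + 1) then F p else 0) -
        (if Γ.level p ≤ 4 * i.1 then F p else 0) = 0 := by
      rw [cumDeg, cumDeg, Finsupp.sum, Finsupp.sum, ← Finset.sum_sub_distrib] at hi
      refine (Finset.sum_eq_zero_iff_of_nonneg fun p _ => ?_).1 hi
      have := hF p
      simp only [Finsupp.coe_zero, Pi.zero_apply] at this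
      split_ifs <;> omega
    rw [cumDeg, Finsupp.sum, Finset.sum_smul, aj, Finsupp.liftAddHom_apply, Finsupp.sum]
    refine Finset.sum_congr rfl fun p hp => ?_
    have h1 := hsub p hp
    have h2 := Finsupp.mem_support_iff.1 hp
    rw [zmultiplesHom_apply]
    by_cases hl : Γ.level p ≤ 4 * i.1
    · rw [if_pos hl, Γ.pos_of_level_le (by omega)]
    · rw [if_neg hl, sub_zero] at h1
      have hl' : ¬Γ.level p ≤ 4 * (i.1 + 1) := fun h => h2 (by rwa [if_pos h] at h1)
      rw [if_neg hl, Γ.pos_of_lt_level (by omega)]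
      simp

/-- A single chip on a loop can realize any class there. Further chips of that loop are put at
`w_i`, where they contribute zero, and leftover chips at the last point. -/
theorem exists_effective {m : ℕ} {a : ∀ i, AddCircle (Γ.circ i)} (h : Γ.IsEffective m a) :
    ∃ F : Γ.graph.Div, 0 ≤ F ∧ Γ.graph.deg F = m ∧ ∀ i, Γ.aj i F = a i := by
  obtain ⟨J, hJ, hJ0, hJm, ha⟩ := h
  have : ∀ i, ∃ z : ℝ, (z : AddCircle (Γ.circ i)) =
      a i - (J i : ℤ) • (Γ.bot i : AddCircle (Γ.circ i)) := fun i =>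
    QuotientAddGroup.mk_surjective _
  choose z hz using this
  let G : Fin g → Γ.graph.Div := fun i => if J (i + 1) = J i then 0 else
    Finsupp.single (Γ.loopPoint i (z i)) 1 +
      Finsupp.single (.vertex (Γ.w i)) ((J (i + 1) : ℤ) - J i - 1)
  refine ⟨(∑ i, G i) + Finsupp.single Γ.lastPoint ((m : ℤ) - J g), ?_, ?_, ?_⟩
  · refine add_nonneg (Finset.sum_nonneg fun i _ => ?_) ?_
    · have := hJ (Nat.le_succ i.1)
      simp only [G]
      split_ifs with h
      · exact le_rfl
      · refine add_nonneg (Finsupp.single_nonneg.2 zero_le_one) (Finsupp.single_nonneg.2 ?_)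
        simp only [Nat.succ_eq_add_one] at this
        omega
    · exact Finsupp.single_nonneg.2 (by omega)
  · have hG : ∀ i : Fin g, Γ.graph.deg (G i) =
        if i.1 < g then ((J (i.1 + 1) : ℕ) : ℤ) - J i.1 else 0 := by
      intro i
      rw [if_pos i.2]
      simp only [G]
      split_ifs with h
      · simp [h]
      · rw [map_add, deg_single, deg_single]; ring
    rw [map_add, map_sum, deg_single, Finset.sum_congr rfl fun i _ => hG i,
      sum_fin_lt_sub (fun n => (J n : ℤ)) g le_rfl, hJ0]
    simp
  · intro k
    have hG : ∀ i : Fin g, Γ.aj k (G i) =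
        (if i = k then a k - (J k : ℤ) • (Γ.bot k : AddCircle (Γ.circ k)) else 0) +
          (if i.1 < k.1 then ((J (i.1 + 1) : ℕ) : ℤ) - J i.1 else 0 : ℤ) •
          (Γ.bot k : AddCircle (Γ.circ k)) := by
      intro i
      simp only [G]
      split_ifs with h h1 h2 h2 h1 h2 h2
      · omega
      · subst h1; simp [ha i h]
      · simp [h]
      · simp
      · omega
      · subst h1
        rw [map_add, aj_single, aj_single, pos_loopPoint, pos_w]
        simp [hz]
      · rw [map_add, aj_single, aj_single, pos_loopPoint, pos_w]
        rw [if_pos (Fin.lt_def.2 h2), if_pos (Fin.lt_def.2 h2), ← add_smul]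
        simp
      · have h3 : k < i := lt_of_le_of_ne (not_lt.1 fun h => h2 (Fin.lt_def.1 h)) (Ne.symm h1)
        rw [map_add, aj_single, aj_single, pos_loopPoint, pos_w]
        simp [h3, h3.not_gt]
    rw [map_add, map_sum, aj_single, pos_lastPoint, Finset.sum_congr rfl fun i _ => hG i,
      Finset.sum_add_distrib, ← Finset.sum_smul, sum_fin_lt_sub (fun n => (J n : ℤ)) k.1 k.2.le,
      hJ0]
    simp

theorem deg_nonneg {F : Γ.graph.Div} (hF : 0 ≤ F) : 0 ≤ Γ.graph.deg F := by
  rw [deg_eq_sum]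
  exact Finset.sum_nonneg fun p _ => hF p

theorem rankAtLeast_iff (D : Γ.graph.Div) (k : ℕ) : Γ.graph.RankAtLeast D k ↔
    ∀ f, Γ.IsEffective k f → ∃ m : ℕ, (m : ℤ) = Γ.graph.deg D - k ∧
      Γ.IsEffective m fun i => Γ.aj i D - f i := by
  constructor
  · intro h f hf
    obtain ⟨F, hF, hk, hFf⟩ := Γ.exists_effective hf
    obtain ⟨D', hD', h⟩ := h F hF hk
    obtain ⟨h1, h2⟩ := (Γ.linEquiv_iff _ _).1 h
    obtain ⟨m, hm⟩ := Int.eq_ofNat_of_zero_le (Γ.deg_nonneg hD')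
    refine ⟨m, ?_, ?_⟩
    · rw [← hm, ← h1, map_sub, hk]
    · have := Γ.isEffective_of_effective hD' hm
      simpa only [← h2, map_sub, hFf] using this
  · intro h F hF hk
    obtain ⟨m, hm, h⟩ := h _ (Γ.isEffective_of_effective hF hk)
    obtain ⟨D', hD', h1, h2⟩ := Γ.exists_effective h
    refine ⟨D', hD', (Γ.linEquiv_iff _ _).2 ⟨?_, fun i => ?_⟩⟩
    · rw [h1, hm, map_sub, hk]
    · rw [h2, map_sub]

/-! ### Growing diagrams and the rank -/

/-- `Grown x n X Y` means that the box `(X, Y)` belongs to the diagram obtained after `n` steps by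
adding in each step the addable boxes on the diagonal selected by the coordinate of `x`. Boxes
with a nonpositive coordinate always belong to it. -/
def Grown (x : Fin g → ℝ) : ℕ → ℤ → ℤ → Prop
  | 0, X, Y => X ≤ 0 ∨ Y ≤ 0
  | n + 1, X, Y => Grown x n X Y ∨ ∃ h : n < g, Grown x n (X - 1) Y ∧ Grown x n X (Y - 1) ∧
      (x ⟨n, h⟩ : AddCircle (Γ.circ ⟨n, h⟩)) =
        (Y - X) • (Γ.bot ⟨n, h⟩ : AddCircle (Γ.circ ⟨n, h⟩))

open Classical in
/-- The greedy sequence of chip numbers for a divisor class. -/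
def greedy (a : ∀ i, AddCircle (Γ.circ i)) : ℕ → ℕ
  | 0 => 0
  | n + 1 => greedy a n + if ∃ h : n < g, a ⟨n, h⟩ =
      (greedy a n : ℤ) • (Γ.bot ⟨n, h⟩ : AddCircle (Γ.circ ⟨n, h⟩)) then 0 else 1

theorem isEffective_greedy {a : ∀ i, AddCircle (Γ.circ i)} {m : ℕ} (hm : Γ.greedy a g ≤ m) :
    Γ.IsEffective m a := by
  refine ⟨Γ.greedy a, monotone_nat_of_le_succ fun n => Nat.le_add_right _ _, rfl, hm, ?_⟩
  intro i hi
  by_contra h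
  rw [greedy, if_neg (by rintro ⟨_, h'⟩; exact h h')] at hi
  omega

/-- If the opposing divisor `f` has fewer than `Y` chips on the first `n` loops, the greedy
effective divisor in the residual class needs at most `n - X` there. This is the sufficiency half of
the rank criterion. -/
theorem greedy_add_le (x : Fin g → ℝ) {f : ∀ i, AddCircle (Γ.circ i)} {J : ℕ → ℕ}
    (hJ : Monotone J) (hf : ∀ i : Fin g, J (i + 1) = J i →
      f i = (J i : ℤ) • (Γ.bot i : AddCircle (Γ.circ i))) (n : ℕ) :
    ∀ X Y : ℤ, Γ.Grown x n X Y → (J n : ℤ) < Y →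
      (Γ.greedy (fun i => (x i : AddCircle (Γ.circ i)) +
        (i.1 : ℤ) • (Γ.bot i : AddCircle (Γ.circ i)) - f i) n : ℤ) + X ≤ n := by
  set a : ∀ i, AddCircle (Γ.circ i) := fun i => (x i : AddCircle (Γ.circ i)) +
        (i.1 : ℤ) • (Γ.bot i : AddCircle (Γ.circ i)) - f i with ha
  induction n with
  | zero =>
    rintro X Y (h | h) hY
    · simpa [greedy] using h
    · omega
  | succ n ih =>
    have hle : Γ.greedy a (n + 1) ≤ Γ.greedy a n + 1 := by
      rw [greedy]; split_ifs <;> omega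
    have hJn := hJ (Nat.le_succ n)
    simp only [Nat.succ_eq_add_one] at hJn
    rintro X Y (h | ⟨hn, h1, h2, h3⟩) hY
    · have := ih X Y h (by omega)
      push_cast; omega
    · by_cases hlt : (J n : ℤ) < Y - 1
      · have := ih X (Y - 1) h2 hlt
        push_cast; omega
      -- Here the opponent has already used `Y - 1` chips and cannot put one on loop `n`. If the
      -- bound for `(X - 1, Y)` is attained, the coordinate condition for the new box says precisely
      -- that the greedy divisor needs no chip on this loop.
      · have h4 := ih (X - 1) Y h1 (by omega)
        rcases lt_or_eq_of_le h4 with h4 | h4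
        · push_cast; omega
        · have hfn := hf ⟨n, hn⟩ (by dsimp only; omega)
          have hfree : Γ.greedy a (n + 1) = Γ.greedy a n := by
            rw [greedy, if_pos, add_zero]
            refine ⟨hn, ?_⟩
            simp only [ha] at h4 ⊢
            rw [hfn, h3, ← add_smul, ← sub_smul]
            congr 1
            dsimp only
            omega
          rw [hfree]; push_cast; omega

theorem exists_sub_ne (i : Fin g) (b c : AddCircle (Γ.circ i)) :
    ∃ f : AddCircle (Γ.circ i), b - f ≠ c := by
  by_contra! h
  have h2 := h 0
  have h3 := h ((Γ.circ i / 2 : ℝ) : AddCircle (Γ.circ i))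
  rw [← h2, sub_right_inj, AddCircle.coe_eq_zero_iff] at h3
  obtain ⟨n, hn⟩ := h3
  have hc := Γ.circ_pos i
  rw [zsmul_eq_mul] at hn
  have h4 : (n : ℝ) = 1 / 2 := by
    have : ((n : ℝ) - 1 / 2) * Γ.circ i = 0 := by linarith
    rcases mul_eq_zero.1 this with h | h
    · linarith
    · exact absurd h hc.ne'
  have h5 : (2 * n : ℤ) = 1 := by
    have : (2 * n : ℝ) = 1 := by linarith
    exact_mod_cast this
  omega

/-- An effective divisor with few chips on the first `n` loops that forces every effective divisor
of the residual class to have many chips on these loops. -/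
def HasAdversary (x : Fin g → ℝ) (n : ℕ) (X Y : ℤ) : Prop :=
  ∃ (J : ℕ → ℕ) (f : ∀ i, AddCircle (Γ.circ i)),
    Monotone J ∧ J 0 = 0 ∧ (∀ m, n ≤ m → J m = J n) ∧ (J n : ℤ) < Y ∧
    (∀ i : Fin g, i.1 < n → J (i + 1) = J i →
      f i = (J i : ℤ) • (Γ.bot i : AddCircle (Γ.circ i))) ∧
    ∀ K : ℕ → ℕ, Monotone K → K 0 = 0 → (∀ i : Fin g, i.1 < n → K (i + 1) = K i →
      (x i : AddCircle (Γ.circ i)) + (i.1 : ℤ) • (Γ.bot i : AddCircle (Γ.circ i)) - f i =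
        (K i : ℤ) • (Γ.bot i : AddCircle (Γ.circ i))) → (n : ℤ) < K n + X

/-- The hypothesis `hext` is a game on one loop: after `k` chips the adversary chooses a new total
`j` and a class `v` such that every admissible passage from `k` to `k'` chips in the residual
divisor exceeds the new threshold. -/
theorem HasAdversary.extend {x : Fin g → ℝ} {n : ℕ} {X X' Y Y' : ℤ} (hn : n < g)
    (h : Γ.HasAdversary x n X' Y')
    (hext : ∀ k : ℕ, (k : ℤ) < Y' → ∃ (j : ℕ) (v : AddCircle (Γ.circ ⟨n, hn⟩)), k ≤ j ∧
      (j : ℤ) < Y ∧ (j = k → v = (k : ℤ) • (Γ.bot ⟨n, hn⟩ : AddCircle (Γ.circ ⟨n, hn⟩))) ∧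
      ∀ k k' : ℕ, (n : ℤ) < k + X' → k ≤ k' →
        (k' = k → (x ⟨n, hn⟩ : AddCircle (Γ.circ ⟨n, hn⟩)) +
          (n : ℤ) • (Γ.bot ⟨n, hn⟩ : AddCircle (Γ.circ ⟨n, hn⟩)) - v =
            (k : ℤ) • (Γ.bot ⟨n, hn⟩ : AddCircle (Γ.circ ⟨n, hn⟩))) → (n : ℤ) + 1 < k' + X) :
    Γ.HasAdversary x (n + 1) X Y := by
  obtain ⟨J, f, hJ, hJ0, hc, hY, hf, hK⟩ := h
  obtain ⟨j, v, hj, hjY, hv, hext⟩ := hext (J n) hY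
  have hJn : ∀ m, J m ≤ J n := fun m => by
    rcases le_total m n with h | h
    · exact hJ h
    · exact (hc m h).le
  refine ⟨fun m => if m ≤ n then J m else j, Function.update f ⟨n, hn⟩ v, ?_, ?_, ?_, ?_, ?_, ?_⟩
  · intro a b hab
    dsimp only
    split_ifs with h1 h2
    · exact hJ hab
    · exact (hJn a).trans hj
    · omega
    · exact le_rfl
  · simp [hJ0]
  · intro m hm
    dsimp only
    rw [if_neg (by omega), if_neg (by omega)]
  · dsimp only
    rwa [if_neg (by omega)]
  · intro i hi h
    dsimp only at h ⊢
    rcases Nat.lt_succ_iff_lt_or_eq.1 hi with hi | hi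
    · have hne : i ≠ ⟨n, hn⟩ := fun h => by rw [h] at hi; simp at hi
      rw [if_pos (by omega), if_pos (by omega)] at h
      rw [Function.update_of_ne hne, if_pos hi.le, hf i hi h]
    · obtain rfl : i = ⟨n, hn⟩ := Fin.ext hi
      rw [if_neg (by simp), if_pos le_rfl] at h
      rw [Function.update_self, if_pos le_rfl, hv h]
  · intro K hKm hK0 hKf
    have h1 := hK K hKm hK0 fun i hi h => by
      have hne : i ≠ ⟨n, hn⟩ := fun h => by rw [h] at hi; simp at hi
      have := hKf i (by omega) h
      rwa [Function.update_of_ne hne] at this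
    have h2 := hext (K n) (K (n + 1)) h1 (hKm (Nat.le_succ n)) fun h => by
      have := hKf ⟨n, hn⟩ (Nat.lt_succ_self n) h
      rwa [Function.update_self] at this
    push_cast; exact h2

/-- If `(X - 1, Y)` has not grown, its adversary already forces enough chips and adds none. If `(X,
Y - 1)` has not grown, the spare chip goes on loop `n`. If both have grown, the coordinate condition
fails, so either a spare chip or its absence forces the residual divisor to spend one. -/
theorem hasAdversary_of_not_grown (x : Fin g → ℝ) (n : ℕ) (hn : n ≤ g) :
    ∀ X Y : ℤ, ¬Γ.Grown x n X Y → Γ.HasAdversary x n X Y := by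
  induction n with
  | zero =>
    intro X Y h
    simp only [Grown, not_or, not_le] at h
    refine ⟨fun _ => 0, 0, monotone_const, rfl, fun _ _ => rfl, h.2, fun i hi => by omega, ?_⟩
    intro K _ _ _
    push_cast; omega
  | succ n ih =>
    intro X Y h
    have hn' : n < g := hn
    specialize ih hn'.le
    -- Only a residual divisor with exactly `n + 1 - X` chips could stay below the new threshold.
    -- The additional chip is placed so that this divisor cannot skip loop `n`.
    have hbump : ∀ k : ℕ, (k : ℤ) < Y - 1 →
        ∃ (j : ℕ) (v : AddCircle (Γ.circ ⟨n, hn'⟩)), k ≤ j ∧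
      (j : ℤ) < Y ∧ (j = k → v = (k : ℤ) • (Γ.bot ⟨n, hn'⟩ : AddCircle (Γ.circ ⟨n, hn'⟩))) ∧
      ∀ k k' : ℕ, (n : ℤ) < k + X → k ≤ k' →
        (k' = k → (x ⟨n, hn'⟩ : AddCircle (Γ.circ ⟨n, hn'⟩)) +
          (n : ℤ) • (Γ.bot ⟨n, hn'⟩ : AddCircle (Γ.circ ⟨n, hn'⟩)) - v =
            (k : ℤ) • (Γ.bot ⟨n, hn'⟩ : AddCircle (Γ.circ ⟨n, hn'⟩))) → (n : ℤ) + 1 < k' + X := by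
      intro k hk
      obtain ⟨v, hv⟩ := Γ.exists_sub_ne ⟨n, hn'⟩ ((x ⟨n, hn'⟩ : AddCircle (Γ.circ ⟨n, hn'⟩)) +
        (n : ℤ) • (Γ.bot ⟨n, hn'⟩ : AddCircle (Γ.circ ⟨n, hn'⟩)))
        ((n + 1 - X) • (Γ.bot ⟨n, hn'⟩ : AddCircle (Γ.circ ⟨n, hn'⟩)))
      refine ⟨k + 1, v, by omega, by push_cast; omega, by omega, ?_⟩
      intro k k' h1 h2 h3
      by_contra h4
      obtain rfl : k' = k := by omega
      refine hv ((h3 rfl).trans ?_)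
      congr 1; omega
    simp only [Grown, not_or, not_exists, not_and] at h
    by_cases h1 : Γ.Grown x n (X - 1) Y
    · by_cases h2 : Γ.Grown x n X (Y - 1)
      · refine (ih X Y h.1).extend Γ hn' fun k hk => ?_
        by_cases hk' : (k : ℤ) < Y - 1
        · exact hbump k hk'
        · refine ⟨k, _, le_rfl, hk, fun _ => rfl, ?_⟩
          intro m m' h4 h5 h6
          by_contra h7
          obtain rfl : m' = m := by omega
          refine h.2 hn' h1 h2 ?_
          have h6 := h6 rfl
          rw [sub_eq_iff_eq_add, ← eq_sub_iff_add_eq, ← add_smul, ← sub_smul] at h6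
          rw [h6]
          congr 1; omega
      · exact (ih X (Y - 1) h2).extend Γ hn' hbump
    · refine (ih (X - 1) Y h1).extend Γ hn' fun k hk => ⟨k, _, le_rfl, hk, fun _ => rfl, ?_⟩
      intro m m' h4 h5 _
      omega

/-- A box belongs to the fully grown diagram if and only if the corresponding rank condition
holds. -/
theorem rankAtLeast_coordDiv_iff (x : Fin g → ℝ) (X : ℤ) (r' : ℕ) :
    Γ.graph.RankAtLeast ((Γ.coordDiv x : Γ.graph.Div) +
      ((g : ℤ) + r' - X) • Finsupp.single Γ.lastPoint 1) r' ↔ Γ.Grown x g X (r' + 1) := by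
  have hdeg : Γ.graph.deg ((Γ.coordDiv x : Γ.graph.Div) +
      ((g : ℤ) + r' - X) • Finsupp.single Γ.lastPoint 1) = g + r' - X := by
    rw [map_add, (AddMonoidHom.mem_ker).1 (Γ.coordDiv x).2, map_zsmul, deg_single]
    simp
  have haj : ∀ i, Γ.aj i ((Γ.coordDiv x : Γ.graph.Div) +
      ((g : ℤ) + r' - X) • Finsupp.single Γ.lastPoint 1) =
      (x i : AddCircle (Γ.circ i)) + (i.1 : ℤ) • (Γ.bot i : AddCircle (Γ.circ i)) := by
    intro i
    rw [map_add, aj_coordDiv, map_zsmul, aj_single, pos_lastPoint]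
    simp
  simp only [rankAtLeast_iff, hdeg, haj]
  constructor
  · intro h
    by_contra hG
    obtain ⟨J, f, hJ, hJ0, -, hY, hf, hK⟩ := Γ.hasAdversary_of_not_grown x g le_rfl _ _ hG
    obtain ⟨m, hm, K, hKm, hK0, hKg, hKf⟩ := h f ⟨J, hJ, hJ0, by omega, fun i => hf i i.2⟩
    have := hK K hKm hK0 fun i _ => hKf i
    omega
  · rintro h f ⟨J, hJ, hJ0, hJg, hf⟩
    have := Γ.greedy_add_le x hJ hf g X _ h (by omega)
    refine ⟨(g - X).toNat, ?_, Γ.isEffective_greedy ?_⟩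
    · rw [Int.toNat_of_nonneg (by omega)]; ring
    · omega

theorem cover_surjective : Function.Surjective Γ.cover := by
  intro c
  obtain ⟨D, rfl⟩ : ∃ D, Γ.graph.toPic0 D = c := QuotientAddGroup.mk_surjective c
  have : ∀ i, ∃ z : ℝ, (z : AddCircle (Γ.circ i)) =
      Γ.aj i D - (i.1 : ℤ) • (Γ.bot i : AddCircle (Γ.circ i)) := fun i =>
    QuotientAddGroup.mk_surjective _
  choose x hx using this
  refine ⟨x, (Γ.toPic0_eq_iff _ _).2 fun i => ?_⟩
  rw [aj_coordDiv, hx, sub_add_cancel]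

theorem cover_eq_iff (x y : Fin g → ℝ) :
    Γ.cover x = Γ.cover y ↔ ∀ i, (x i : AddCircle (Γ.circ i)) = y i := by
  refine (Γ.toPic0_eq_iff _ _).trans (forall_congr' fun i => ?_)
  rw [aj_coordDiv, aj_coordDiv, add_left_inj]

theorem rankAtLeast_congr {D D' : Γ.graph.Div0} (h : Γ.graph.toPic0 D = Γ.graph.toPic0 D')
    (E : Γ.graph.Div) (k : ℕ) : Γ.graph.RankAtLeast ((D : Γ.graph.Div) + E) k ↔
      Γ.graph.RankAtLeast ((D' : Γ.graph.Div) + E) k := by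
  rw [toPic0_eq_iff] at h
  simp only [rankAtLeast_iff, map_add, h, (AddMonoidHom.mem_ker).1 D.2,
    (AddMonoidHom.mem_ker).1 D'.2]

theorem cover_mem_brillNoether_iff {lam : Set (ℤ × ℤ)} (hlam : ∀ b ∈ lam, 1 ≤ b.2)
    (x : Fin g → ℝ) : Γ.cover x ∈ Γ.brillNoether lam ↔ ∀ b ∈ lam, Γ.Grown x g b.1 b.2 := by
  constructor
  · rintro ⟨D, hD, h⟩ b hb
    obtain ⟨r', hr'⟩ := Int.eq_ofNat_of_zero_le (sub_nonneg.2 (hlam b hb))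
    have hb2 : b.2 = r' + 1 := by omega
    rw [hb2, ← rankAtLeast_coordDiv_iff, ← Γ.rankAtLeast_congr hD]
    apply h
    convert hb using 1
    ext
    · ring
    · simp [hb2]
  · intro h
    refine ⟨Γ.coordDiv x, rfl, fun d' r' hb => ?_⟩
    have := (Γ.rankAtLeast_coordDiv_iff x _ r').2 (h _ hb)
    convert this using 4
    ring

theorem Grown.mono {x : Fin g → ℝ} {m n : ℕ} (hmn : m ≤ n) {X Y : ℤ} (h : Γ.Grown x m X Y) :
    Γ.Grown x n X Y := by
  induction hmn with
  | refl => exact h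
  | step _ ih => exact Or.inl ih

theorem grown_of_nonpos (x : Fin g → ℝ) (n : ℕ) {X Y : ℤ} (h : X ≤ 0 ∨ Y ≤ 0) :
    Γ.Grown x n X Y := Grown.mono Γ (Nat.zero_le n) h

theorem Grown.of_le {x : Fin g → ℝ} {n : ℕ} {X Y X' Y' : ℤ} (h : Γ.Grown x n X Y)
    (hX : X' ≤ X) (hY : Y' ≤ Y) : Γ.Grown x n X' Y' := by
  induction n generalizing X Y with
  | zero => simp only [Grown] at h ⊢; omega
  | succ n ih =>
    rcases h with h | ⟨hn, h1, h2, h3⟩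
    · exact Or.inl (ih h hX hY)
    · rcases hX.lt_or_eq with hX | rfl
      · exact Or.inl (ih h1 (by omega) hY)
      rcases hY.lt_or_eq with hY | rfl
      · exact Or.inl (ih h2 le_rfl (by omega))
      · exact Or.inr ⟨hn, h1, h2, h3⟩

end ChainOfLoops

/-! ### Tableaux, their tori, and genericity -/

/-- A finite Young diagram, as a set of boxes with positive coordinates. -/
structure IsYoungDiagram (lam : Set (ℤ × ℤ)) : Prop where
  finite : lam.Finite
  pos : ∀ b ∈ lam, 1 ≤ b.1 ∧ 1 ≤ b.2
  lower : ∀ b ∈ lam, ∀ X Y, 1 ≤ X → X ≤ b.1 → 1 ≤ Y → Y ≤ b.2 → (X, Y) ∈ lam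

/-- From the corner box `(1, 1)` one reaches `(X, Y)` through `X + Y - 2` unit steps, and `t`
increases at each of them; its values start at zero. -/
theorem IsYoungDiagram.add_le {lam : Set (ℤ × ℤ)} (h : IsYoungDiagram lam) {g : ℕ}
    {t : lam → Fin g} (ht : StrictMono t) (b : lam) : b.1.1 + b.1.2 ≤ (t b).1 + 2 := by
  have key : ∀ n : ℕ, ∀ b : lam, b.1.1 + b.1.2 = n + 2 → n ≤ (t b).1 := by
    intro n
    induction n with
    | zero => intro b _; exact Nat.zero_le _
    | succ n ih =>
      rintro ⟨⟨X, Y⟩, hb⟩ hn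
      have hp := h.pos _ hb
      dsimp only at hn hp
      by_cases hX : 1 < X
      · let b' : lam := ⟨(X - 1, Y), h.lower _ hb _ _ (by omega) (by dsimp only; omega) hp.2 le_rfl⟩
        have h1 : b' < ⟨(X, Y), hb⟩ := by
          rw [Subtype.mk_lt_mk, Prod.mk_lt_mk]; left; omega
        have h2 := ih b' (by simp only [b']; push_cast at hn; omega)
        have h3 := Fin.lt_def.1 (ht h1)
        omega
      · let b' : lam := ⟨(X, Y - 1), h.lower _ hb _ _ hp.1 le_rfl (by push_cast at hn; omega)
          (by dsimp only; omega)⟩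
        have h1 : b' < ⟨(X, Y), hb⟩ := by
          rw [Subtype.mk_lt_mk, Prod.mk_lt_mk]; right; omega
        have h2 := ih b' (by simp only [b']; push_cast at hn; omega)
        have h3 := Fin.lt_def.1 (ht h1)
        omega
  have hp := h.pos _ b.2
  have := key (b.1.1 + b.1.2 - 2).toNat b (by omega)
  omega

namespace ChainOfLoops

variable {g : ℕ} (Γ : ChainOfLoops g)

/-- The preimage in `ℝ^g` of the torus of a tableau. -/
def tableauTorus {lam : Set (ℤ × ℤ)} (t : lam → Fin g) : Set (Fin g → ℝ) :=
  {x | ∀ b : lam, (x (t b) : AddCircle (Γ.circ (t b))) =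
    (b.1.2 - b.1.1) • (Γ.bot (t b) : AddCircle (Γ.circ (t b)))}

/-- The tableau sends each box to the loop at which it is added. It is strictly increasing because a
box is added only when `(X - 1, Y)` and `(X, Y - 1)` are already present; the converse follows by
adding boxes in the order of `t`. -/
theorem grown_iff_exists_tableau {lam : Set (ℤ × ℤ)} (hlam : IsYoungDiagram lam)
    (x : Fin g → ℝ) : (∀ b ∈ lam, Γ.Grown x g b.1 b.2) ↔
      ∃ t : lam → Fin g, StrictMono t ∧ x ∈ Γ.tableauTorus t := by
  classical
  constructor
  · intro h
    have h1 : ∀ b : lam, ∃ n : Fin g, ¬Γ.Grown x n b.1.1 b.1.2 ∧ Γ.Grown x (n + 1) b.1.1 b.1.2 := by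
      intro b
      have hex : ∃ n, Γ.Grown x n b.1.1 b.1.2 := ⟨g, h _ b.2⟩
      have h0 : Nat.find hex ≠ 0 := fun h0 => by
        have h1 := Nat.find_spec hex
        have hp := hlam.pos _ b.2
        rw [h0] at h1
        simp only [Grown] at h1
        omega
      have hle : Nat.find hex ≤ g := Nat.find_min' hex (h _ b.2)
      refine ⟨⟨Nat.find hex - 1, by omega⟩, Nat.find_min hex (by dsimp only; omega), ?_⟩
      dsimp only
      rw [Nat.sub_add_cancel (by omega)]
      exact Nat.find_spec hex
    choose t ht ht' using h1
    have hstep : ∀ b, Γ.Grown x (t b) (b.1.1 - 1) b.1.2 ∧ Γ.Grown x (t b) b.1.1 (b.1.2 - 1) ∧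
        (x (t b) : AddCircle (Γ.circ (t b))) =
          (b.1.2 - b.1.1) • (Γ.bot (t b) : AddCircle (Γ.circ (t b))) := by
      intro b
      rcases ht' b with h | ⟨_, h⟩
      · exact absurd h (ht b)
      · exact h
    refine ⟨t, fun b b' hb => ?_, fun b => (hstep b).2.2⟩
    rw [Fin.lt_def]
    by_contra hle
    obtain ⟨h1, h2, -⟩ := hstep b'
    refine ht b (Grown.mono Γ (not_lt.1 hle) ?_)
    rcases Prod.lt_iff.1 (show b.1 < b'.1 from hb) with ⟨h3, h4⟩ | ⟨h3, h4⟩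
    · exact Grown.of_le Γ h1 (by omega) h4
    · exact Grown.of_le Γ h2 h3 (by omega)
  · rintro ⟨t, ht, hx⟩
    have key : ∀ n : ℕ, ∀ b : lam, (t b).1 < n → Γ.Grown x n b.1.1 b.1.2 := by
      intro n
      induction n with
      | zero => intro b hb; omega
      | succ n ih =>
        intro b hb
        rcases Nat.lt_succ_iff_lt_or_eq.1 hb with hb | hb
        · exact Or.inl (ih b hb)
        · subst hb
          have hp := hlam.pos _ b.2
          refine Or.inr ⟨(t b).2, ?_, ?_, hx b⟩
          · by_cases h1 : 1 ≤ b.1.1 - 1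
            · refine ih ⟨(b.1.1 - 1, b.1.2), hlam.lower _ b.2 _ _ h1 (by omega) hp.2 le_rfl⟩
                (Fin.lt_def.1 (ht ?_))
              refine Prod.lt_iff.2 (Or.inl ⟨?_, le_rfl⟩)
              dsimp only; omega
            · exact Γ.grown_of_nonpos x _ (Or.inl (by omega))
          · by_cases h1 : 1 ≤ b.1.2 - 1
            · refine ih ⟨(b.1.1, b.1.2 - 1), hlam.lower _ b.2 _ _ hp.1 le_rfl h1 (by omega)⟩
                (Fin.lt_def.1 (ht ?_))
              refine Prod.lt_iff.2 (Or.inr ⟨le_rfl, ?_⟩)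
              dsimp only; omega
            · exact Γ.grown_of_nonpos x _ (Or.inr (by omega))
    exact fun b hb => key g ⟨b, hb⟩ (t ⟨b, hb⟩).2

theorem cover_mem_brillNoether_iff_exists_tableau {lam : Set (ℤ × ℤ)} (hlam : IsYoungDiagram lam)
    (x : Fin g → ℝ) : Γ.cover x ∈ Γ.brillNoether lam ↔
      ∃ t : lam → Fin g, StrictMono t ∧ x ∈ Γ.tableauTorus t := by
  rw [Γ.cover_mem_brillNoether_iff fun b hb => (hlam.pos b hb).2, Γ.grown_iff_exists_tableau hlam]

/-- A coincidence reads `(k - k') * bot = m * (bot + top)` with `0 < m < k - k'`, so `top / bot` is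
the ratio of `k - k' - m` to `m`, two positive integers with sum `k - k'`. -/
theorem zsmul_bot_injective {Γ : ChainOfLoops g} (hΓ : Γ.IsGeneric) (i : Fin g) {k k' : ℤ}
    (h1 : k - k' ≤ 2 * g - 2) (h2 : k' - k ≤ 2 * g - 2)
    (h : k • (Γ.bot i : AddCircle (Γ.circ i)) = k' • (Γ.bot i : AddCircle (Γ.circ i))) :
    k = k' := by
  wlog hlt : k' < k generalizing k k'
  · by_contra hne
    exact hne (this h2 h1 h.symm (by omega)).symm
  exfalso
  rw [← sub_eq_zero, ← sub_smul, ← AddCircle.coe_zsmul, AddCircle.coe_eq_zero_iff] at h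
  obtain ⟨m, hm⟩ := h
  simp only [zsmul_eq_mul, circ] at hm
  have hb := Γ.bot_pos i
  have ht := Γ.top_pos i
  have hk : (0 : ℝ) < (k - k' : ℤ) := by exact_mod_cast sub_pos.2 hlt
  have hm0 : (0 : ℝ) < m := by
    by_contra hm0
    push Not at hm0
    have := mul_pos hk hb
    have := mul_nonneg (neg_nonneg.2 hm0) (add_pos hb ht).le
    linarith
  have hmt := mul_pos hm0 ht
  have hkm : (m : ℝ) < (k - k' : ℤ) := by
    by_contra hkm
    push Not at hkm
    have := mul_le_mul_of_nonneg_right hkm hb.le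
    linarith
  have hm0' : 0 < m := by exact_mod_cast hm0
  have hkm' : m < k - k' := by exact_mod_cast hkm
  refine hΓ i (k - k' - m).toNat m.toNat (by omega) (by omega) (by omega) ?_
  have e1 : (((k - k' - m).toNat : ℕ) : ℝ) = (k - k' : ℤ) - m := by
    have : (((k - k' - m).toNat : ℕ) : ℤ) = k - k' - m := Int.toNat_of_nonneg (by omega)
    exact_mod_cast congrArg (Int.cast : ℤ → ℝ) this
  have e2 : ((m.toNat : ℕ) : ℝ) = m := by
    have : ((m.toNat : ℕ) : ℤ) = m := Int.toNat_of_nonneg (by omega)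
    exact_mod_cast congrArg (Int.cast : ℤ → ℝ) this
  rw [e1, e2, div_eq_div_iff hb.ne' hm0.ne']
  linarith

/-- By `IsYoungDiagram.add_le` the boxes satisfy `X + Y ≤ g + 1`. Their contents thus lie between
`-(g - 1)` and `g - 1` and differ by at most `2g - 2`, the range covered by genericity. -/
theorem content_eq {Γ : ChainOfLoops g} (hΓ : Γ.IsGeneric) {lam lam' : Set (ℤ × ℤ)}
    (hlam : IsYoungDiagram lam) (hlam' : IsYoungDiagram lam') {t : lam → Fin g}
    {t' : lam' → Fin g} (ht : StrictMono t) (ht' : StrictMono t') {x : Fin g → ℝ}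
    (hx : x ∈ Γ.tableauTorus t) (hx' : x ∈ Γ.tableauTorus t') {b : lam} {b' : lam'}
    (h : t b = t' b') : b.1.2 - b.1.1 = b'.1.2 - b'.1.1 := by
  have h1 := hx b
  have h2 : ∀ i, t' b' = i → (x i : AddCircle (Γ.circ i)) =
      (b'.1.2 - b'.1.1) • (Γ.bot i : AddCircle (Γ.circ i)) := by
    rintro _ rfl
    exact hx' b'
  have p1 := hlam.pos _ b.2
  have p2 := hlam'.pos _ b'.2
  have q1 := hlam.add_le ht b
  have q2 := hlam'.add_le ht' b'
  exact zsmul_bot_injective hΓ (t b) (by omega) (by omega) (h1.symm.trans (h2 _ h.symm))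

/-- Boxes with the same value lie on one diagonal, where any two boxes are comparable. -/
theorem tableau_injective {Γ : ChainOfLoops g} (hΓ : Γ.IsGeneric) {lam : Set (ℤ × ℤ)}
    (hlam : IsYoungDiagram lam) {t : lam → Fin g} (ht : StrictMono t) {x : Fin g → ℝ}
    (hx : x ∈ Γ.tableauTorus t) : Function.Injective t := by
  intro b b' h
  have hc := content_eq hΓ hlam hlam ht ht hx hx h
  rcases lt_trichotomy b.1.1 b'.1.1 with h1 | h1 | h1
  · exact absurd h (ht (Prod.lt_iff.2 (Or.inl ⟨h1, by omega⟩))).ne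
  · exact Subtype.ext (Prod.ext h1 (by omega))
  · exact absurd h.symm (ht (Prod.lt_iff.2 (Or.inl ⟨h1, by omega⟩))).ne

end ChainOfLoops

/-! ### Local polyhedral structure of Brill–Noether loci -/

/-- The affine subspace of points that agree with `p` in the coordinates from `I`. -/
def coordSubspace {g : ℕ} (p : Fin g → ℝ) (I : Set (Fin g)) : Set (Fin g → ℝ) :=
  {x | ∀ i ∈ I, x i = p i}

theorem isPolyhedron_coordSubspace {g : ℕ} (p : Fin g → ℝ) (I : Set (Fin g)) :
    IsPolyhedron (coordSubspace p I) := by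
  refine ⟨(fun i => (LinearMap.proj i, p i)) '' I ∪ (fun i => (-LinearMap.proj i, -p i)) '' I,
    (I.toFinite.image _).union (I.toFinite.image _), ?_⟩
  ext x
  simp only [coordSubspace, mem_ofPred_eq, mem_union, mem_image]
  constructor
  · rintro h _ (⟨i, hi, rfl⟩ | ⟨i, hi, rfl⟩)
    · exact (h i hi).le
    · simpa using (h i hi).ge
  · intro h i hi
    refine le_antisymm (h _ (Or.inl ⟨i, hi, rfl⟩)) ?_
    simpa using h _ (Or.inr ⟨i, hi, rfl⟩)

/-- The direction of `coordSubspace p I`. -/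
def coordDirection {g : ℕ} (I : Set (Fin g)) : Submodule ℝ (Fin g → ℝ) :=
  ⨅ i ∈ I, LinearMap.ker (LinearMap.proj i : (Fin g → ℝ) →ₗ[ℝ] ℝ)

theorem coordSubspace_eq {g : ℕ} (p : Fin g → ℝ) (I : Set (Fin g)) :
    coordSubspace p I = (AffineSubspace.mk' p (coordDirection I) : Set (Fin g → ℝ)) := by
  ext x
  simp [coordSubspace, coordDirection, AffineSubspace.mem_mk', sub_eq_zero]

theorem finrank_vectorSpan_coordSubspace {g : ℕ} (p : Fin g → ℝ) (I : Set (Fin g)) :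
    Module.finrank ℝ (vectorSpan ℝ (coordSubspace p I)) = g - I.ncard := by
  classical
  rw [coordSubspace_eq, ← AffineSubspace.direction_eq_vectorSpan, AffineSubspace.direction_mk',
    coordDirection]
  rw [(LinearMap.iInfKerProjEquiv ℝ (fun _ : Fin g => ℝ) (I := Iᶜ) (J := I) disjoint_compl_left
    (by simp)).finrank_eq]
  rw [Module.finrank_fintype_fun_eq_card, ← Nat.card_eq_fintype_card, Nat.card_coe_set_eq,
    Set.ncard_compl]
  simp

theorem intrinsicInterior_coordSubspace {g : ℕ} (p : Fin g → ℝ) (I : Set (Fin g)) :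
    p ∈ intrinsicInterior ℝ (coordSubspace p I) := by
  have hp : p ∈ affineSpan ℝ (coordSubspace p I) := subset_affineSpan ℝ _ (fun _ _ => rfl)
  refine ⟨⟨p, hp⟩, ?_, rfl⟩
  have : ((↑) ⁻¹' coordSubspace p I : Set (affineSpan ℝ (coordSubspace p I))) = univ := by
    rw [eq_univ_iff_forall]
    rintro ⟨y, hy⟩
    rw [coordSubspace_eq, AffineSubspace.affineSpan_coe] at hy
    change y ∈ coordSubspace p I
    rw [coordSubspace_eq]
    exact hy
  rw [this, interior_univ]
  trivial

/-- Two real numbers with the same image in the circle are equal or at least `c` apart; if `y` does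
not map to `a`, neither do nearby points. -/
theorem eventually_coe_eq_iff {c : ℝ} (hc : 0 < c) (y : ℝ) (a : AddCircle c) :
    ∀ᶠ z : ℝ in 𝓝 y, (z : AddCircle c) = a ↔ (y : AddCircle c) = a ∧ z = y := by
  by_cases h : (y : AddCircle c) = a
  · filter_upwards [Metric.ball_mem_nhds y hc] with z hz
    constructor
    · intro hza
      refine ⟨h, ?_⟩
      rw [← h, ← sub_eq_zero, ← AddCircle.coe_sub, AddCircle.coe_eq_zero_iff] at hza
      obtain ⟨n, hn⟩ := hza
      rw [Metric.mem_ball, Real.dist_eq, ← hn, zsmul_eq_mul, abs_mul, abs_of_pos hc] at hz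
      have : |(n : ℝ)| < 1 := by
        by_contra h1
        push Not at h1
        have := mul_le_mul_of_nonneg_right h1 hc.le
        linarith
      have hn0 : n = 0 := by
        have : |n| < 1 := by exact_mod_cast this
        exact Int.abs_lt_one_iff.1 this
      rw [hn0, zero_smul] at hn
      linarith
    · rintro ⟨-, rfl⟩; exact h
  · have := Fact.mk hc
    have hcont : Continuous fun z : ℝ => (z : AddCircle c) := AddCircle.continuous_mk' c
    filter_upwards [hcont.continuousAt.eventually_ne h] with z hz
    simp [h, hz]

namespace ChainOfLoops

variable {g : ℕ} (Γ : ChainOfLoops g)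

theorem eventually_mem_tableauTorus {lam : Set (ℤ × ℤ)} (hlam : lam.Finite) (t : lam → Fin g)
    (p : Fin g → ℝ) : ∀ᶠ x in 𝓝 p, x ∈ Γ.tableauTorus t ↔
      p ∈ Γ.tableauTorus t ∧ x ∈ coordSubspace p (range t) := by
  have := hlam.to_subtype
  have : ∀ᶠ x in 𝓝 p, ∀ b : lam, ((x (t b) : AddCircle (Γ.circ (t b))) =
      (b.1.2 - b.1.1) • (Γ.bot (t b) : AddCircle (Γ.circ (t b)))) ↔
      (p (t b) : AddCircle (Γ.circ (t b))) =
      (b.1.2 - b.1.1) • (Γ.bot (t b) : AddCircle (Γ.circ (t b))) ∧ x (t b) = p (t b) :=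
    eventually_all.2 fun b => ((continuous_apply (t b)).tendsto p).eventually
      (eventually_coe_eq_iff (Γ.circ_pos (t b)) (p (t b)) _)
  filter_upwards [this] with x hx
  simp only [tableauTorus, mem_ofPred_eq, coordSubspace, forall_mem_range, ← forall_and]
  exact forall_congr' hx

theorem eventually_cover_mem {lam : Set (ℤ × ℤ)} (hlam : IsYoungDiagram lam) (p : Fin g → ℝ) :
    Γ.cover ⁻¹' Γ.brillNoether lam =ᶠ[𝓝 p]
      ⋃₀ ((fun t => coordSubspace p (range t)) ''
        {t : lam → Fin g | StrictMono t ∧ p ∈ Γ.tableauTorus t}) := by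
  have := hlam.finite.to_subtype
  have : ∀ᶠ x in 𝓝 p, ∀ t : lam → Fin g, x ∈ Γ.tableauTorus t ↔
      p ∈ Γ.tableauTorus t ∧ x ∈ coordSubspace p (range t) :=
    eventually_all.2 fun t => Γ.eventually_mem_tableauTorus hlam.finite t p
  filter_upwards [this] with x hx
  refine propext ((Γ.cover_mem_brillNoether_iff_exists_tableau hlam x).trans ?_)
  simp only [hx]
  constructor
  · rintro ⟨t, ht, hp, h⟩
    exact ⟨_, ⟨t, ⟨ht, hp⟩, rfl⟩, h⟩
  · rintro ⟨_, ⟨t, ⟨ht, hp⟩, rfl⟩, h⟩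
    exact ⟨t, ht, hp, h⟩

/-- The subtraction is truncated, but if `λ` has more than `g` boxes there is no injective tableau
and the family of polyhedra is empty. -/
theorem isPure_brillNoether {Γ : ChainOfLoops g} (hΓ : Γ.IsGeneric) {lam : Set (ℤ × ℤ)}
    (hlam : IsYoungDiagram lam) : Γ.IsPure (Γ.brillNoether lam) (g - lam.ncard) := by
  intro p
  have := hlam.finite.to_subtype
  refine ⟨_, (toFinite _).image _, ?_, Γ.eventually_cover_mem hlam p⟩
  rintro _ ⟨t, ⟨ht, hp⟩, rfl⟩
  refine ⟨isPolyhedron_coordSubspace _ _, ?_⟩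
  rw [finrank_vectorSpan_coordSubspace, ← image_univ,
    ncard_image_of_injective _ (tableau_injective hΓ hlam ht hp), ncard_univ,
    Nat.card_coe_set_eq]

theorem ncard_le_of_nonempty {Γ : ChainOfLoops g} (hΓ : Γ.IsGeneric) {lam : Set (ℤ × ℤ)}
    (hlam : IsYoungDiagram lam) (h : (Γ.brillNoether lam).Nonempty) : lam.ncard ≤ g := by
  obtain ⟨c, hc⟩ := h
  obtain ⟨x, rfl⟩ := Γ.cover_surjective c
  obtain ⟨t, ht, hx⟩ := (Γ.cover_mem_brillNoether_iff_exists_tableau hlam x).1 hc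
  have := hlam.finite.to_subtype
  rw [← Nat.card_coe_set_eq]
  simpa using Nat.card_le_card_of_injective t (tableau_injective hΓ hlam ht hx)

theorem mem_relint_of_forall_range_eq {lam : Set (ℤ × ℤ)} (hlam : IsYoungDiagram lam)
    {p : Fin g → ℝ} (hp : Γ.cover p ∈ Γ.brillNoether lam)
    (h : ∀ t t' : lam → Fin g, StrictMono t → StrictMono t' → p ∈ Γ.tableauTorus t →
      p ∈ Γ.tableauTorus t' → range t = range t') :
    Γ.cover p ∈ Γ.relint (Γ.brillNoether lam) := by
  obtain ⟨t, ht, hpt⟩ := (Γ.cover_mem_brillNoether_iff_exists_tableau hlam p).1 hp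
  refine ⟨p, ⟨coordSubspace p (range t), isPolyhedron_coordSubspace _ _,
    intrinsicInterior_coordSubspace _ _, ?_⟩, rfl⟩
  convert Γ.eventually_cover_mem hlam p using 1
  have : (fun t => coordSubspace p (range t)) ''
      {t : lam → Fin g | StrictMono t ∧ p ∈ Γ.tableauTorus t} =
        {coordSubspace p (range t)} := by
    ext C
    constructor
    · rintro ⟨t', ⟨ht', hp'⟩, rfl⟩
      rw [mem_singleton_iff, h t t' ht ht' hpt hp']
    · rintro rfl
      exact ⟨t, ⟨ht, hpt⟩, rfl⟩
  rw [this, sUnion_singleton]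

/-! ### Regular points and comparison of tableaux -/

/-- The points of `ℝ^g` at which all tori of tableaux of shape `lam` have the same direction. -/
def regularLocus (lam : Set (ℤ × ℤ)) : Set (Fin g → ℝ) :=
  {p | ∀ t t' : lam → Fin g, StrictMono t → StrictMono t' → p ∈ Γ.tableauTorus t →
      p ∈ Γ.tableauTorus t' → range t = range t'}

/-- Every torus meeting a small neighbourhood of `p` contains `p`, so no new tableaux appear near
`p`. -/
theorem isOpen_regularLocus {lam : Set (ℤ × ℤ)} (hlam : lam.Finite) :
    IsOpen (Γ.regularLocus lam) := by
  have := hlam.to_subtype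
  rw [isOpen_iff_mem_nhds]
  intro p hp
  have : ∀ᶠ x in 𝓝 p, ∀ t : lam → Fin g, x ∈ Γ.tableauTorus t ↔
      p ∈ Γ.tableauTorus t ∧ x ∈ coordSubspace p (range t) :=
    eventually_all.2 fun t => Γ.eventually_mem_tableauTorus hlam t p
  filter_upwards [this] with x hx t t' ht ht' hxt hxt'
  exact hp t t' ht ht' ((hx t).1 hxt).1 ((hx t').1 hxt').1

theorem mem_regularLocus_congr {lam : Set (ℤ × ℤ)} {x y : Fin g → ℝ}
    (h : Γ.cover x = Γ.cover y) : x ∈ Γ.regularLocus lam ↔ y ∈ Γ.regularLocus lam := by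
  rw [cover_eq_iff] at h
  have : ∀ t : lam → Fin g, x ∈ Γ.tableauTorus t ↔ y ∈ Γ.tableauTorus t := fun t => by
    simp only [tableauTorus, mem_ofPred_eq, h]
  simp only [regularLocus, mem_ofPred_eq, this]

/-- The regular locus is a union of fibres of `cover`, so it is the full preimage of its image in
the coinduced topology. -/
theorem isOpen_cover_image_regularLocus {lam : Set (ℤ × ℤ)} (hlam : lam.Finite) :
    IsOpen (Γ.cover '' Γ.regularLocus lam) := by
  rw [isOpen_coinduced]
  convert Γ.isOpen_regularLocus hlam using 1
  ext x
  constructor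
  · rintro ⟨y, hy, h⟩
    exact (Γ.mem_regularLocus_congr h).1 hy
  · exact fun hx => ⟨x, hx, rfl⟩

theorem continuous_cover : Continuous Γ.cover := continuous_coinduced_rng

/-- Two tableaux agree on a rectangle if they have compatible contents and the rectangle shares its
outer corner with the boundary of the larger diagram. -/
theorem tableau_eq_restrict {lam : Set (ℤ × ℤ)} (hlam : IsYoungDiagram lam) {rows cols : ℤ}
    (hsub : rectDiagram rows cols ⊆ lam) (hcorner : (cols + 1, rows + 1) ∉ lam)
    {s : rectDiagram rows cols → Fin g} {t : lam → Fin g} (hs : StrictMono s) (ht : StrictMono t)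
    (hst : ∀ b, ∃ b' : lam, s b = t b' ∧ b.1.2 - b.1.1 = b'.1.2 - b'.1.1)
    (b : rectDiagram rows cols) : s b = t ⟨b.1, hsub b.2⟩ := by
  apply le_antisymm
  -- Induction on the distance from the outer corner. At the corner, `b'` cannot lie further out on
  -- the diagonal by `hcorner`. Elsewhere, if it did, a neighbour `c` of `b` with `b < c` and `c ≤
  -- b'` would give `s b < s c ≤ t c ≤ t b' = s b`.
  · have key : ∀ n : ℕ, ∀ b : rectDiagram rows cols, (cols - b.1.1) + (rows - b.1.2) = n →
        s b ≤ t ⟨b.1, hsub b.2⟩ := by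
      intro n
      induction n with
      | zero =>
        intro b hn
        obtain ⟨b', h1, h2⟩ := hst b
        rw [h1]
        refine ht.monotone ?_
        obtain ⟨-, h3, -, h4⟩ := b.2
        have h5 : b'.1.1 ≤ cols := by
          by_contra h6
          exact hcorner (hlam.lower _ b'.2 _ _ (by have := b.2.1; omega) (by omega)
            (by have := b.2.2.2.1; omega) (by omega))
        exact ⟨by change b'.1.1 ≤ b.1.1; omega, by change b'.1.2 ≤ b.1.2; omega⟩
      | succ n ih =>
        intro b hn
        obtain ⟨b', h1, h2⟩ := hst b
        obtain ⟨p1, p2, p3, p4⟩ := b.2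
        rw [h1]
        refine ht.monotone ?_
        by_contra hle
        have h5 : b.1.1 + 1 ≤ b'.1.1 ∧ b.1.2 + 1 ≤ b'.1.2 := by
          by_contra h6
          exact hle ⟨by change b'.1.1 ≤ b.1.1; omega, by change b'.1.2 ≤ b.1.2; omega⟩
        obtain ⟨c, hbc, hcn, hcb'⟩ : ∃ c : rectDiagram rows cols, b < c ∧
            (cols - c.1.1) + (rows - c.1.2) = n ∧ c.1 ≤ b'.1 := by
          by_cases hc : b.1.1 < cols
          · refine ⟨⟨(b.1.1 + 1, b.1.2), by refine ⟨?_, ?_, ?_, ?_⟩ <;> dsimp only <;> omega⟩,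
              Prod.lt_iff.2 (Or.inl ⟨?_, le_rfl⟩), ?_, ⟨h5.1, ?_⟩⟩ <;> dsimp only <;>
              push_cast at hn <;> omega
          · refine ⟨⟨(b.1.1, b.1.2 + 1), by
                push_cast at hn
                refine ⟨?_, ?_, ?_, ?_⟩ <;> dsimp only <;> omega⟩,
              Prod.lt_iff.2 (Or.inr ⟨le_rfl, ?_⟩), ?_, ⟨?_, h5.2⟩⟩ <;> dsimp only <;>
              push_cast at hn <;> omega
        have h6 := (hs hbc).trans_le (ih c hcn)
        rw [h1] at h6
        exact h6.not_ge (ht.monotone hcb')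
    obtain ⟨p1, p2, p3, p4⟩ := b.2
    exact key ((cols - b.1.1) + (rows - b.1.2)).toNat b (by omega)
  -- Induction on the column. If `b'` were strictly further in, the diagonal predecessor `c` of `b`
  -- would give `t b' ≤ t c ≤ s c < s b = t b'`.
  · have key : ∀ n : ℕ, ∀ b : rectDiagram rows cols, b.1.1 ≤ n → t ⟨b.1, hsub b.2⟩ ≤ s b := by
      intro n
      induction n with
      | zero => intro b hn; have := b.2.1; omega
      | succ n ih =>
        intro b hn
        obtain ⟨b', h1, h2⟩ := hst b
        obtain ⟨p1, p2, p3, p4⟩ := b.2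
        rw [h1]
        refine ht.monotone ?_
        by_contra hle
        have h5 : b'.1.1 + 1 ≤ b.1.1 ∧ b'.1.2 + 1 ≤ b.1.2 := by
          by_contra h6
          exact hle ⟨by change b.1.1 ≤ b'.1.1; omega, by change b.1.2 ≤ b'.1.2; omega⟩
        have q := hlam.pos _ b'.2
        let c : rectDiagram rows cols := ⟨(b.1.1 - 1, b.1.2 - 1), by
          refine ⟨?_, ?_, ?_, ?_⟩ <;> dsimp only <;> omega⟩
        have hcb : c < b := Prod.lt_iff.2 (Or.inl ⟨by simp only [c]; omega, by simp only [c]; omega⟩)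
        have h6 := (ih c (by simp only [c]; push_cast at hn; omega)).trans_lt (hs hcb)
        rw [h1] at h6
        refine h6.not_ge (ht.monotone ⟨?_, ?_⟩)
        · change b'.1.1 ≤ b.1.1 - 1; omega
        · change b'.1.2 ≤ b.1.2 - 1; omega
    exact key b.1.1.toNat b (by omega)

end ChainOfLoops

/-! ### Unions of diagrams, density of regular points, and the diagrams of a Schubert index -/

theorem isYoungDiagram_rectDiagram (rows cols : ℤ) : IsYoungDiagram (rectDiagram rows cols) where
  finite := ((finite_Icc 1 cols).prod (finite_Icc 1 rows)).subset
    fun _ h => ⟨⟨h.1, h.2.1⟩, ⟨h.2.2.1, h.2.2.2⟩⟩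
  pos _ h := ⟨h.1, h.2.2.1⟩
  lower _ h _ _ h1 h2 h3 h4 := ⟨h1, h2.trans h.2.1, h3, h4.trans h.2.2.2⟩

theorem isYoungDiagram_lambdaUnion (g d : ℕ) {r : ℕ} (α : Fin (r + 1) → ℕ) (j : Fin (r + 1)) :
    IsYoungDiagram (lambdaUnion g d α j) where
  finite := (toFinite _).biUnion fun i _ => (isYoungDiagram_rectDiagram _ _).finite
  pos b hb := by
    obtain ⟨i, -, hb⟩ := mem_iUnion₂.1 hb
    exact (isYoungDiagram_rectDiagram _ _).pos b hb
  lower b hb X Y h1 h2 h3 h4 := by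
    obtain ⟨i, hi, hb⟩ := mem_iUnion₂.1 hb
    exact mem_iUnion₂.2 ⟨i, hi, (isYoungDiagram_rectDiagram _ _).lower b hb X Y h1 h2 h3 h4⟩

namespace ChainOfLoops

variable {g : ℕ} (Γ : ChainOfLoops g)

theorem brillNoether_anti {lam lam' : Set (ℤ × ℤ)} (h : lam ⊆ lam') :
    Γ.brillNoether lam' ⊆ Γ.brillNoether lam := by
  rintro c ⟨D, hD, hr⟩
  exact ⟨D, hD, fun d' r' hb => hr d' r' (h hb)⟩

/-- The two memberships may come with different divisors in the same class; reading them through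
`cover` turns both into conditions on one point `x`. -/
theorem brillNoether_union {lam lam' : Set (ℤ × ℤ)} (h : IsYoungDiagram lam)
    (h' : IsYoungDiagram lam') :
    Γ.brillNoether (lam ∪ lam') = Γ.brillNoether lam ∩ Γ.brillNoether lam' := by
  ext c
  obtain ⟨x, rfl⟩ := Γ.cover_surjective c
  rw [mem_inter_iff, Γ.cover_mem_brillNoether_iff fun b hb => (h.pos b hb).2,
    Γ.cover_mem_brillNoether_iff fun b hb => (h'.pos b hb).2, Γ.cover_mem_brillNoether_iff]
  · exact ⟨fun H => ⟨fun b hb => H b (Or.inl hb), fun b hb => H b (Or.inr hb)⟩,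
      fun H b hb => hb.elim (H.1 b) (H.2 b)⟩
  · rintro b (hb | hb)
    exacts [(h.pos b hb).2, (h'.pos b hb).2]

theorem brillNoether_subset_closure {Γ : ChainOfLoops g} (hΓ : Γ.IsGeneric) {lam : Set (ℤ × ℤ)}
    (hlam : IsYoungDiagram lam) {rows cols : ℤ} (hsub : rectDiagram rows cols ⊆ lam)
    (hcorner : (cols + 1, rows + 1) ∉ lam) : Γ.brillNoether lam ⊆
      closure (Γ.cover '' Γ.regularLocus (rectDiagram rows cols) ∩ Γ.brillNoether lam) := by
  classical
  intro c hc
  obtain ⟨x, rfl⟩ := Γ.cover_surjective c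
  obtain ⟨t, ht, hx⟩ := (Γ.cover_mem_brillNoether_iff_exists_tableau hlam x).1 hc
  let y : ℝ → Fin g → ℝ := fun ε i => if i ∈ range t then x i else x i + ε
  have hy : Continuous y := continuous_pi fun i => by
    by_cases h : i ∈ range t
    · simp only [y, h, if_true]; fun_prop
    · simp only [y, h, if_false]; fun_prop
  -- The values of `ε` for which some `x i + ε` becomes a multiple of `bot i` modulo the
  -- circumference; they are countable, so zero is a limit of other values.
  let B : Set ℝ := ⋃ (i : Fin g) (k : ℤ) (m : ℤ), {k * Γ.bot i + m * Γ.circ i - x i}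
  have hB : B.Countable := countable_iUnion fun i => countable_iUnion fun k =>
    countable_iUnion fun m => countable_singleton _
  have h0 : (0 : ℝ) ∈ closure Bᶜ := by
    rw [(hB.dense_compl ℝ).closure_eq]; trivial
  have hy0 : y 0 = x := by
    ext i; simp [y]
  rw [← hy0]
  have hcover : Continuous fun ε => Γ.cover (y ε) := Γ.continuous_cover.comp hy
  refine map_mem_closure (f := fun ε => Γ.cover (y ε)) hcover h0 fun ε hε => ?_
  have hyt : y ε ∈ Γ.tableauTorus t := fun b => by
    simp only [y, mem_range_self, if_true]
    exact hx b
  have hrange : ∀ i, ∀ k : ℤ, (y ε i : AddCircle (Γ.circ i)) =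
      k • (Γ.bot i : AddCircle (Γ.circ i)) → i ∈ range t := by
    intro i k h
    by_contra hi
    simp only [y, hi, if_false] at h
    rw [← AddCircle.coe_zsmul, ← sub_eq_zero, ← AddCircle.coe_sub,
      AddCircle.coe_eq_zero_iff] at h
    obtain ⟨m, hm⟩ := h
    refine hε (mem_iUnion.2 ⟨i, mem_iUnion₂.2 ⟨k, m, ?_⟩⟩)
    simp only [zsmul_eq_mul] at hm
    rw [mem_singleton_iff]; linarith
  have hmu := isYoungDiagram_rectDiagram rows cols
  have hs : ∀ s : rectDiagram rows cols → Fin g, StrictMono s → y ε ∈ Γ.tableauTorus s →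
      s = fun b => t ⟨b.1, hsub b.2⟩ := by
    intro s hs hys
    refine funext (tableau_eq_restrict hlam hsub hcorner hs ht fun b => ?_)
    obtain ⟨b', hb'⟩ := hrange (s b) _ (hys b)
    exact ⟨b', hb'.symm, content_eq hΓ hmu hlam hs ht hys hyt hb'.symm⟩
  refine ⟨⟨y ε, fun s s' h h' hys hys' => ?_, rfl⟩,
    (Γ.cover_mem_brillNoether_iff_exists_tableau hlam _).2 ⟨t, ht, hyt⟩⟩
  rw [hs s h hys, hs s' h' hys']

end ChainOfLoops

theorem lambdaUnion_succ (g d : ℕ) {r : ℕ} (α : Fin (r + 1) → ℕ) (j : Fin r) :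
    lambdaUnion g d α j.succ = lambdaUnion g d α j.castSucc ∪ lambdaRect g d α j.succ := by
  ext b
  simp only [lambdaUnion, mem_union, mem_iUnion₂]
  constructor
  · rintro ⟨i, hi, hb⟩
    rcases hi.lt_or_eq with hi | rfl
    · exact Or.inl ⟨i, Fin.le_castSucc_iff.2 hi, hb⟩
    · exact Or.inr hb
  · rintro (⟨i, hi, hb⟩ | hb)
    · exact ⟨i, (Fin.le_castSucc_iff.1 hi).le, hb⟩
    · exact ⟨_, le_rfl, hb⟩

/-- As `α` is monotone, `λ_j` is the widest of `λ_0, …, λ_j` and no wider than `λ_{j+1}`, whose `r -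
j` rows bound the height. -/
theorem muRect_eq_inter (g d : ℕ) {r : ℕ} {α : Fin (r + 1) → ℕ} (hα : Monotone α) (j : Fin r) :
    lambdaUnion g d α j.castSucc ∩ lambdaRect g d α j.succ = muRect g d α j.castSucc := by
  have h1 : α j.castSucc ≤ α j.succ := hα j.castSucc_lt_succ.le
  ext b
  simp only [lambdaUnion, mem_inter_iff, mem_iUnion₂, lambdaRect, muRect, rectDiagram,
    mem_ofPred_eq, Fin.val_succ, Fin.val_castSucc]
  constructor
  · rintro ⟨⟨i, hi, hb⟩, hb'⟩
    have := hα hi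
    push_cast at hb'
    omega
  · rintro hb
    refine ⟨⟨j.castSucc, le_rfl, ?_⟩, ?_⟩
    · simp only [Fin.val_castSucc]; omega
    · push_cast; omega

/-- Row `r - j + 1` is above `λ_{j+1}`, and the earlier rectangles reach at most column `g - d + r +
α_j`. This is the corner condition of `tableau_eq_restrict` for `μ_j`. -/
theorem corner_notMem_lambdaUnion (g d : ℕ) {r : ℕ} {α : Fin (r + 1) → ℕ} (hα : Monotone α)
    (j : Fin r) : ((g : ℤ) - d + r + α j.castSucc + 1, (r : ℤ) - (j.castSucc : ℕ) + 1) ∉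
      lambdaUnion g d α j.succ := by
  intro h
  rw [lambdaUnion_succ] at h
  simp only [lambdaUnion, mem_union, mem_iUnion₂, lambdaRect, rectDiagram,
    mem_ofPred_eq, Fin.val_succ, Fin.val_castSucc] at h
  rcases h with ⟨i, hi, hb⟩ | hb
  · have := hα hi
    omega
  · push_cast at hb; omega

end

theorem mainTheorem5 {g : ℕ} (Γ : ChainOfLoops g) (hΓ : Γ.IsGeneric) (r d : ℕ)
    (α : Fin (r + 1) → ℕ) (hα : IsSchubertIndex r d α) (j : Fin r) :
    Γ.brillNoether (lambdaUnion g d α j.castSucc) ∩ Γ.brillNoether (lambdaRect g d α j.succ) =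
        Γ.brillNoether (lambdaUnion g d α j.succ) ∧
      Γ.IntersectProperly (Γ.brillNoether (lambdaUnion g d α j.castSucc))
        (Γ.brillNoether (lambdaRect g d α j.succ)) (Γ.brillNoether (muRect g d α j.castSucc)) ∧
      ∃ U : Set Γ.Pic0,
        (∃ O : Set Γ.Pic0, IsOpen O ∧ U = O ∩ Γ.brillNoether (lambdaUnion g d α j.succ)) ∧
        Γ.brillNoether (lambdaUnion g d α j.succ) ⊆ closure U ∧
        U ⊆ Γ.relint (Γ.brillNoether (muRect g d α j.castSucc)) := by
  have hA := isYoungDiagram_lambdaUnion g d α j.castSucc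
  have hAB := isYoungDiagram_lambdaUnion g d α j.succ
  have hB : IsYoungDiagram (lambdaRect g d α j.succ) :=
    isYoungDiagram_rectDiagram _ _
  have hmu : IsYoungDiagram (muRect g d α j.castSucc) :=
    isYoungDiagram_rectDiagram _ _
  have hunion := lambdaUnion_succ g d α j
  have hinter := muRect_eq_inter g d hα.1 j
  have hmuA : muRect g d α j.castSucc ⊆ lambdaUnion g d α j.castSucc :=
    hinter ▸ inter_subset_left
  have hmuB : muRect g d α j.castSucc ⊆ lambdaRect g d α j.succ := hinter ▸ inter_subset_right
  have hmuAB : muRect g d α j.castSucc ⊆ lambdaUnion g d α j.succ :=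
    hunion ▸ hmuA.trans subset_union_left
  have heq : Γ.brillNoether (lambdaUnion g d α j.castSucc) ∩
      Γ.brillNoether (lambdaRect g d α j.succ) = Γ.brillNoether (lambdaUnion g d α j.succ) := by
    rw [hunion, Γ.brillNoether_union hA hB]
  refine ⟨heq, ⟨Γ.brillNoether_anti hmuA, Γ.brillNoether_anti hmuB, _, _, _,
    ChainOfLoops.isPure_brillNoether hΓ hA, ChainOfLoops.isPure_brillNoether hΓ hB,
    ChainOfLoops.isPure_brillNoether hΓ hmu, ?_⟩, ?_⟩
  · rw [heq]
    intro hne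
    refine ⟨_, ?_, ChainOfLoops.isPure_brillNoether hΓ hAB⟩
    -- Inclusion–exclusion is the dimension formula. Nonemptiness bounds all four diagrams by `g`
    -- boxes, so no subtraction is truncated.
    have hcard := ncard_union_add_ncard_inter _ _ hA.finite hB.finite
    rw [← hunion, hinter] at hcard
    have h1 := ChainOfLoops.ncard_le_of_nonempty hΓ hAB hne
    have h2 := ncard_le_ncard hmuAB hAB.finite
    have h3 : (lambdaUnion g d α j.castSucc).ncard ≤ (lambdaUnion g d α j.succ).ncard :=
      ncard_le_ncard (hunion ▸ subset_union_left) hAB.finite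
    have h4 : (lambdaRect g d α j.succ).ncard ≤ (lambdaUnion g d α j.succ).ncard :=
      ncard_le_ncard (hunion ▸ subset_union_right) hAB.finite
    omega
  · refine ⟨_, ⟨_, Γ.isOpen_cover_image_regularLocus hmu.finite, rfl⟩,
      ChainOfLoops.brillNoether_subset_closure hΓ hAB hmuAB
        (corner_notMem_lambdaUnion g d hα.1 j), ?_⟩
    rintro _ ⟨⟨x, hx, rfl⟩, hc⟩
    exact Γ.mem_relint_of_forall_range_eq hmu (Γ.brillNoether_anti hmuAB hc) hx
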